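/- Fix a finite relational schema $\Sigma$, all of whose relation symbols have positive arity, and a Boolean query $q = p_1 \vee \dots \vee p_m$ over $\Sigma$, where each $p_i$ is an existentially closed conjunction of atoms $R(\bar t)$, negated atoms $\neg R(\bar t)$ and inequalities $t \neq t'$ (terms being variables or constants) such that every variable of a negated atom or inequality of $p_i$ also occurs in a positive atom of $p_i$ (a UCQ$^\neg$). For a database $D$ (a finite set of facts over $\Sigma$) with active domain $\mathrm{const}(D)$, put $$D^\pm = \{+f : f \in D\} \cup \{-R(\bar c) : R \in \Sigma,\ \bar c \in \mathrm{const}(D)^{\mathrm{arity}(R)},\ R(\bar c) \notin D\},$$ a database over the schema with symbols $+R$ and $-R$ for each $R\in\Sigma$. Let $q^\pm$ be obtained from $q$ by replacing each negated atom $\neg R(\bar t)$ by the atom $-R(\bar t)$ and each positive atom $R(\bar t)$ by $+R(\bar t)$, keeping the inequalities. A signed support of $q$ in $D$ is a set $S \subseteq D^\pm$ with $S \models q^\pm$, and a signed fact $\alpha$ is signed-relevant for $q$ in $D$ if it belongs to some inclusion-minimal signed support of $q$ in $D$. Then the following problem, for the fixed query $q$, is in (uniform) $\mathrm{AC}^0$: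 given a database $D$ and a signed fact $\alpha$, decide whether $\alpha$ is signed-relevant for $q$ in $D$. That is, constants being named by bit strings and an input being written as a word that lists $\alpha$ followed by the facts of $D$, the language of all words that encode a pair $(D,\alpha)$ with $\alpha$ signed-relevant for $q$ in $D$ is recognized by a family $(C_n)_{n \ge 0}$ of Boolean circuits (one for each word length $n$) with unbounded fan-in, constant depth and size polynomial in $n$. The family is moreover first-order uniform: gates are named by a tag from a fixed finite set and a fixed-length tuple of numbers in $\{0,\dots,n\}$, and the gates, labels, wires and output are definable by first-order formulas, independent of $n$, over $(\{0,\dots,n\}; \le, +, \times)$. -/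

import Mathlib

namespace SignedRelevance

/-! ### Schemas, facts and databases -/

/-- A relational schema: finitely many relation symbols, each of positive arity. -/
structure Schema where
  Rel : Type
  finite_rel : Finite Rel
  arity : Rel → ℕ
  arity_pos : ∀ R, 0 < arity R

/-- A relation symbol of `σ` applied to a tuple of elements of `T` of the right length. -/
structure RelApp (σ : Schema) (T : Type) where
  rel : σ.Rel
  args : Fin (σ.arity rel) → T

/-- Facts over the set `C` of constants. A database is a finite set of facts. -/
abbrev Fact (σ : Schema) (C : Type) : Type := RelApp σ C

/-- Variables. -/
abbrev Var : Type := ℕ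

/-- Terms: constants or variables. -/
inductive QTerm (C : Type) : Type
  | const (c : C)
  | var (x : Var)

/-- Relational atoms. -/
abbrev Atom (σ : Schema) (C : Type) : Type := RelApp σ (QTerm C)

/-- The value of a term under a valuation of the variables. -/
def QTerm.eval {C : Type} (ν : Var → C) : QTerm C → C
  | .const c => c
  | .var x => ν x

/-- The fact obtained from an atom by a valuation of the variables. -/
def groundAtom {σ : Schema} {C : Type} (ν : Var → C) (a : Atom σ C) : Fact σ C :=
  ⟨a.rel, fun i => (a.args i).eval ν⟩

/-- The variable `x` occurs in the atom `a`. -/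
def OccursIn {σ : Schema} {C : Type} (x : Var) (a : Atom σ C) : Prop :=
  ∃ i, a.args i = QTerm.var x

/-- The constants that occur in a set of facts. -/
def activeDomain {σ : Schema} {C : Type} (D : Set (Fact σ C)) : Set C :=
  {c | ∃ f ∈ D, ∃ i, f.args i = c}

/-! ### Queries -/

/-- A Boolean conjunctive query with safe negations and inequalities:
the existential closure of the conjunction of the atoms in `pos`, the negations of the atoms
in `neg`, and the inequalities `t ≠ t'` for `(t, t')` in `ineq`. -/
structure CQNeg (σ : Schema) (C : Type) where
  pos : List (Atom σ C)
  neg : List (Atom σ C)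
  ineq : List (QTerm C × QTerm C)
  safe_neg : ∀ a ∈ neg, ∀ x, OccursIn x a → ∃ b ∈ pos, OccursIn x b
  safe_ineq : ∀ e ∈ ineq, ∀ x, e.1 = QTerm.var x ∨ e.2 = QTerm.var x → ∃ b ∈ pos, OccursIn x b

/-- A finite union of such queries. -/
abbrev UCQNeg (σ : Schema) (C : Type) : Type := List (CQNeg σ C)

/-- `ν` is a satisfying assignment of `p` on the set `D` of facts. -/
def CQNeg.SatBy {σ : Schema} {C : Type} (p : CQNeg σ C) (D : Set (Fact σ C)) (ν : Var → C) :
    Prop :=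
  (∀ a ∈ p.pos, groundAtom ν a ∈ D) ∧
  (∀ a ∈ p.neg, groundAtom ν a ∉ D) ∧
  (∀ e ∈ p.ineq, e.1.eval ν ≠ e.2.eval ν)

/-- `D ⊨ q`. -/
def UCQNeg.Holds {σ : Schema} {C : Type} (q : UCQNeg σ C) (D : Set (Fact σ C)) : Prop :=
  ∃ p ∈ q, ∃ ν : Var → C, p.SatBy D ν

/-! ### Signed facts, signed supports, signed relevance -/

/-- The signed schema, with the symbols `+R = (true, R)` and `-R = (false, R)`. -/
def Schema.signed (σ : Schema) : Schema where
  Rel := Bool × σ.Rel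
  finite_rel := by
    have := σ.finite_rel
    infer_instance
  arity R := σ.arity R.2
  arity_pos R := σ.arity_pos R.2

/-- The signed atom or fact `+R(t)` (`s = true`) or `-R(t)` (`s = false`). -/
def withSign {σ : Schema} {T : Type} (s : Bool) (a : RelApp σ T) : RelApp σ.signed T :=
  ⟨(s, a.rel), a.args⟩

/-- Signed facts. -/
abbrev SignedFact (σ : Schema) (C : Type) : Type := Fact σ.signed C

/-- The signed database `D±`: the facts of `D` with a positive sign, and the facts outside `D`
over the active domain of `D` with a negative sign. -/
def signedDb {σ : Schema} {C : Type} (D : Finset (Fact σ C)) : Set (SignedFact σ C) :=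
  {α | ∃ f ∈ D, α = withSign true f} ∪
  {α | ∃ f : Fact σ C, (∀ i, f.args i ∈ activeDomain (D : Set (Fact σ C))) ∧ f ∉ D ∧
    α = withSign false f}

/-- The signed version of a conjunctive query: `R(t)` becomes `+R(t)`, and `¬ R(t)` becomes the
positive atom `-R(t)`; inequalities stay. -/
def CQNeg.signed {σ : Schema} {C : Type} (p : CQNeg σ C) : CQNeg σ.signed C where
  pos := p.pos.map (withSign true) ++ p.neg.map (withSign false)
  neg := []
  ineq := p.ineq
  safe_neg := by simp
  safe_ineq := by
    intro e he x hx
    obtain ⟨b, hb, i, hi⟩ := p.safe_ineq e he x hx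
    exact ⟨withSign true b, List.mem_append_left _ (List.mem_map_of_mem hb), i, hi⟩

/-- The signed version `q±` of `q`. -/
def UCQNeg.signed {σ : Schema} {C : Type} (q : UCQNeg σ C) : UCQNeg σ.signed C :=
  List.map CQNeg.signed q

/-- `S` is a signed support of `q` in `D`. -/
def IsSignedSupport {σ : Schema} {C : Type} (q : UCQNeg σ C) (D : Finset (Fact σ C))
    (S : Set (SignedFact σ C)) : Prop :=
  S ⊆ signedDb D ∧ UCQNeg.Holds (UCQNeg.signed q) S

/-- `α` is signed-relevant for `q` in `D`: it belongs to an inclusion-minimal signed support. -/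
def IsSignedRelevant {σ : Schema} {C : Type} (q : UCQNeg σ C) (D : Finset (Fact σ C))
    (α : SignedFact σ C) : Prop :=
  ∃ S : Set (SignedFact σ C), Minimal (IsSignedSupport q D) S ∧ α ∈ S

/-! ### Boolean circuits -/

/-- Gate labels of circuits reading words of length `n` over the alphabet `A`. An input gate
`input i a` tests whether the `i`-th letter is `a`. -/
inductive Label (A : Type) (n : ℕ) : Type
  | and
  | or
  | not
  | input (i : Fin n) (a : A)

/-- A circuit for words of length `n` over `A`: a finite acyclic graph of gates, with AND- and
OR-gates of arbitrary fan-in. `wire g h` says that the value of `h` is an input of `g`. -/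
structure Circuit (A : Type) (n : ℕ) where
  Gate : Type
  finite_gate : Finite Gate
  label : Gate → Label A n
  wire : Gate → Gate → Prop
  out : Gate
  acyclic : WellFounded (fun h g => wire g h)
  not_fanin : ∀ g, label g = Label.not → ∃! h, wire g h
  input_fanin : ∀ g i a, label g = Label.input i a → ∀ h, ¬ wire g h

/-- The truth value of a gate on the word `w`. -/
def Circuit.eval {A : Type} {n : ℕ} (c : Circuit A n) (w : Fin n → A) : c.Gate → Prop :=
  c.acyclic.fix fun g ih =>
    match c.label g with
    | Label.and => ∀ h, ∀ hw : c.wire g h, ih h hw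
    | Label.or => ∃ h, ∃ hw : c.wire g h, ih h hw
    | Label.not => ∃ h, ∃ hw : c.wire g h, ¬ ih h hw
    | Label.input i a => w i = a

/-- The circuit accepts the word `w`. -/
def Circuit.Accepts {A : Type} {n : ℕ} (c : Circuit A n) (w : Fin n → A) : Prop :=
  c.eval w c.out

/-- The number of gates. -/
noncomputable def Circuit.size {A : Type} {n : ℕ} (c : Circuit A n) : ℕ :=
  Nat.card c.Gate

/-- Every directed path has at most `d` wires, expressed by a height function that drops along
each wire. -/
def Circuit.DepthLE {A : Type} {n : ℕ} (c : Circuit A n) (d : ℕ) : Prop :=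
  ∃ height : c.Gate → ℕ, (∀ g h, c.wire g h → height h < height g) ∧ ∀ g, height g ≤ d

/-! ### First-order uniformity -/

/-- The relation symbols of bounded arithmetic: `x ≤ y`, `x + y = z` and `x * y = z`. -/
inductive NumRel : ℕ → Type
  | le : NumRel 2
  | add : NumRel 3
  | mul : NumRel 3

/-- The first-order language of bounded arithmetic. -/
def numLang : FirstOrder.Language := ⟨fun _ => Empty, NumRel⟩

/-- The numbers `0, …, n` with order and with addition and multiplication as relations. -/
instance numStructure (n : ℕ) : numLang.Structure (Fin (n + 1)) where
  funMap := fun f _ => Empty.elim f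
  RelMap := fun {_} r =>
    match r with
    | NumRel.le => fun v => (v 0 : ℕ) ≤ v 1
    | NumRel.add => fun v => (v 0 : ℕ) + v 1 = v 2
    | NumRel.mul => fun v => (v 0 : ℕ) * v 1 = v 2

/-- A relation on the numbers `0, …, n`, given for each `n`, is defined by one first-order
formula of bounded arithmetic for all `n`. -/
def UniformlyDefinable {ι : Type} (P : ∀ n : ℕ, (ι → Fin (n + 1)) → Prop) : Prop :=
  ∃ φ : numLang.Formula ι, ∀ (n : ℕ) (v : ι → Fin (n + 1)), φ.Realize v ↔ P n v

/-- First-order uniformity of a circuit family: the gates of the `n`-th circuit can be named by a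
tag from a fixed finite set and a tuple of fixed length of numbers `0, …, n`, in such a way that
the set of gates, the output gate, the labels and the wires are first-order definable in bounded
arithmetic. -/
def FOUniform {A : Type} (c : ∀ n : ℕ, Circuit A n) : Prop :=
  ∃ (t k : ℕ) (name : ∀ n, (c n).Gate → Fin t × (Fin k → Fin (n + 1))),
    (∀ n, Function.Injective (name n)) ∧
    (∀ τ, UniformlyDefinable fun n (v : Fin k → Fin (n + 1)) => ∃ g, name n g = (τ, v)) ∧
    (∀ τ, UniformlyDefinable fun n (v : Fin k → Fin (n + 1)) => name n (c n).out = (τ, v)) ∧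
    (∀ τ, UniformlyDefinable fun n (v : Fin k → Fin (n + 1)) =>
      ∃ g, name n g = (τ, v) ∧ (c n).label g = Label.and) ∧
    (∀ τ, UniformlyDefinable fun n (v : Fin k → Fin (n + 1)) =>
      ∃ g, name n g = (τ, v) ∧ (c n).label g = Label.or) ∧
    (∀ τ, UniformlyDefinable fun n (v : Fin k → Fin (n + 1)) =>
      ∃ g, name n g = (τ, v) ∧ (c n).label g = Label.not) ∧
    (∀ τ a, UniformlyDefinable fun n (v : Fin k ⊕ Unit → Fin (n + 1)) =>
      ∃ g i, name n g = (τ, fun j => v (Sum.inl j)) ∧ (c n).label g = Label.input i a ∧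
        (v (Sum.inr ()) : ℕ) = i) ∧
    (∀ τ τ', UniformlyDefinable fun n (v : Fin k ⊕ Fin k → Fin (n + 1)) =>
      ∃ g h, name n g = (τ, fun j => v (Sum.inl j)) ∧ name n h = (τ', fun j => v (Sum.inr j)) ∧
        (c n).wire g h)

/-- The class (uniform) AC⁰: languages recognized by a first-order uniform family of circuits of
constant depth and polynomial size, with gates of unbounded fan-in. -/
def InAC0 {A : Type} [Finite A] (L : Language A) : Prop :=
  ∃ c : ∀ n : ℕ, Circuit A n,
    (∃ d : ℕ, ∀ n, (c n).DepthLE d) ∧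
    (∃ p : Polynomial ℕ, ∀ n, (c n).size ≤ p.eval n) ∧
    FOUniform c ∧
    ∀ (n : ℕ) (w : Fin n → A), (c n).Accepts w ↔ List.ofFn w ∈ L

/-! ### The decision problem -/

/-- For the purpose of encoding inputs, constants are their names, which are bit strings. -/
abbrev Const : Type := List Bool

/-- The letters used to write down databases and signed facts. -/
inductive Letter (σ : Schema) : Type
  | bit (b : Bool)
  | sep
  | sign (s : Bool)
  | rel (R : σ.Rel)

instance (σ : Schema) : Finite (Letter σ) := by
  have := σ.finite_rel
  refine Finite.of_surjective
    (fun x : (Bool ⊕ Unit) ⊕ (Bool ⊕ σ.Rel) =>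
      match x with
      | Sum.inl (Sum.inl b) => Letter.bit b
      | Sum.inl (Sum.inr _) => Letter.sep
      | Sum.inr (Sum.inl s) => Letter.sign s
      | Sum.inr (Sum.inr R) => Letter.rel R) ?_
  rintro (b | _ | s | R)
  · exact ⟨Sum.inl (Sum.inl b), rfl⟩
  · exact ⟨Sum.inl (Sum.inr ()), rfl⟩
  · exact ⟨Sum.inr (Sum.inl s), rfl⟩
  · exact ⟨Sum.inr (Sum.inr R), rfl⟩

/-- A tuple of constants: each constant is written as a separator followed by its bits. -/
def encodeTuple (σ : Schema) {k : ℕ} (c : Fin k → Const) : List (Letter σ) :=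
  (List.ofFn c).flatMap fun b => Letter.sep :: b.map Letter.bit

/-- A fact: the relation symbol followed by the arguments. -/
def encodeFact {σ : Schema} (f : Fact σ Const) : List (Letter σ) :=
  Letter.rel f.rel :: encodeTuple σ f.args

/-- A signed fact: the sign, the relation symbol and the arguments. -/
def encodeSignedFact {σ : Schema} (α : SignedFact σ Const) : List (Letter σ) :=
  Letter.sign α.rel.1 :: Letter.rel α.rel.2 :: encodeTuple σ α.args

/-- `w` encodes the input `(D, α)`: it consists of `α`, followed by the facts of `D` listed in
some order (repetitions are harmless). -/
def Encodes {σ : Schema} (w : List (Letter σ)) (D : Finset (Fact σ Const))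
    (α : SignedFact σ Const) : Prop :=
  ∃ l : List (Fact σ Const), (∀ f, f ∈ l ↔ f ∈ D) ∧
    w = encodeSignedFact α ++ l.flatMap encodeFact

/-- The problem, for the fixed query `q`: given `D` and `α`, is `α` signed-relevant for `q`
in `D`? -/
def signedRelevanceProblem {σ : Schema} (q : UCQNeg σ Const) : Language (Letter σ) :=
  {w | ∃ (D : Finset (Fact σ Const)) (α : SignedFact σ Const),
    Encodes w D α ∧ IsSignedRelevant q D α}

end SignedRelevance

/-! A relation between words and tuples of positions in them that is first-order definable from the
letters and bounded arithmetic is in AC⁰: take as gates the subformulas instantiated at tuples of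
positions, where a quantifier is a gate of unbounded fan-in.

By safety, the minimal signed supports of `q` in `D` are the minimal images of the positive atoms of
`q±` under the assignments that satisfy `q±` in `D±`. Only finitely many variables matter, and their
values lie in the active domain, so that each of them is written somewhere in the input and is
given by the position where its name begins. Relevance thus amounts to a fixed number of quantifiers
over positions, in front of conditions about facts written at positions. Comparing two constants
means comparing their names bit by bit, at equal offsets from their first positions: this is where
addition is needed. -/

namespace SignedRelevance

section Circuits

open FirstOrder Language BoundedFormula

theorem finite_setOf_reflTransGen {α : Type*} {r : α → α → Prop} (wf : WellFounded r)
    (hr : ∀ y, {x | r x y}.Finite) (y : α) : {x | Relation.ReflTransGen r x y}.Finite := by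
  induction y using wf.induction with
  | _ y ih =>
    refine (((hr y).biUnion ih).insert y).subset fun x hx => ?_
    rcases Relation.ReflTransGen.cases_tail_iff _ _ _ |>.1 hx with rfl | ⟨z, hxz, hzy⟩
    · exact Set.mem_insert _ _
    · exact Or.inr (Set.mem_biUnion hzy hxz)

/-! ### Uniform circuit families -/

namespace UniformlyDefinable

variable {ι κ : Type} {P Q : ∀ n : ℕ, (ι → Fin (n + 1)) → Prop}

theorem congr (hP : UniformlyDefinable P) (h : ∀ n v, P n v ↔ Q n v) : UniformlyDefinable Q := by
  obtain ⟨φ, hφ⟩ := hP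
  exact ⟨φ, fun n v => (hφ n v).trans (h n v)⟩

theorem const (p : Prop) : UniformlyDefinable fun n (_ : ι → Fin (n + 1)) => p := by
  by_cases hp : p
  · exact ⟨⊤, fun n v => by simp [hp]⟩
  · exact ⟨⊥, fun n v => by simp [hp]⟩

theorem not (hP : UniformlyDefinable P) : UniformlyDefinable fun n v => ¬ P n v := by
  obtain ⟨φ, hφ⟩ := hP
  exact ⟨φ.not, fun n v => by simp [hφ]⟩

theorem and (hP : UniformlyDefinable P) (hQ : UniformlyDefinable Q) :
    UniformlyDefinable fun n v => P n v ∧ Q n v := by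
  obtain ⟨φ, hφ⟩ := hP
  obtain ⟨ψ, hψ⟩ := hQ
  exact ⟨φ ⊓ ψ, fun n v => by simp [hφ, hψ]⟩

theorem forall_finite {β : Type} [Finite β] {P : β → ∀ n : ℕ, (ι → Fin (n + 1)) → Prop}
    (hP : ∀ b, UniformlyDefinable (P b)) : UniformlyDefinable fun n v => ∀ b, P b n v := by
  choose φ hφ using hP
  exact ⟨Formula.iInf φ, fun n v => by simp [hφ]⟩

theorem eq (i j : ι) : UniformlyDefinable fun n (v : ι → Fin (n + 1)) => v i = v j :=
  ⟨Term.equal (.var i) (.var j), fun n v => by simp [Formula.realize_equal]⟩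

theorem le (i j : ι) : UniformlyDefinable fun n (v : ι → Fin (n + 1)) => v i ≤ v j :=
  ⟨Relations.formula (L := numLang) (n := 2) NumRel.le ![.var i, .var j],
    fun _ _ => Formula.realize_rel⟩

theorem eq_zero (i : ι) : UniformlyDefinable fun n (v : ι → Fin (n + 1)) => v i = 0 :=
  ⟨Relations.formula (L := numLang) (n := 3) NumRel.add ![.var i, .var i, .var i], fun n v => by
    have add_self_iff : (v i : ℕ) + v i = v i ↔ v i = 0 := by
      rw [Fin.ext_iff, Nat.add_eq_right, Fin.val_zero]
    exact Formula.realize_rel.trans add_self_iff⟩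

theorem lt_last (i : ι) : UniformlyDefinable fun n (v : ι → Fin (n + 1)) => (v i : ℕ) < n := by
  obtain ⟨φ, hφ⟩ := le (Sum.inr () : ι ⊕ Unit) (Sum.inl i)
  refine ⟨(Formula.iAlls Unit φ).not, fun n v => ?_⟩
  have lt_last_iff : v i < Fin.last n ↔ ¬ ∀ x : Unit → Fin (n + 1), x () ≤ v i :=
    ⟨fun h hx => h.not_ge (hx fun _ => Fin.last n),
      fun h => lt_of_not_ge fun hi => h fun x => (Fin.le_last (x ())).trans hi⟩
  simp only [Formula.realize_not, Formula.realize_iAlls, hφ, Sum.elim_inl, Sum.elim_inr]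
  exact lt_last_iff.symm

end UniformlyDefinable

namespace Circuit

variable {A : Type} {n : ℕ} {c : Circuit A n} {w : Fin n → A} {g : c.Gate}

theorem eval_iff :
    c.eval w g ↔
      match c.label g with
      | Label.and => ∀ h, c.wire g h → c.eval w h
      | Label.or => ∃ h, c.wire g h ∧ c.eval w h
      | Label.not => ∃ h, c.wire g h ∧ ¬ c.eval w h
      | Label.input i a => w i = a := by
  conv_lhs => rw [Circuit.eval, WellFounded.fix_eq]
  cases c.label g with
  | and => exact Iff.rfl
  | or => exact exists_congr fun h => exists_prop
  | not => exact exists_congr fun h => exists_prop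
  | input i a => exact Iff.rfl

theorem eval_of_label_and (hg : c.label g = Label.and) :
    c.eval w g ↔ ∀ h, c.wire g h → c.eval w h := by
  rw [eval_iff, hg]

theorem eval_of_label_or (hg : c.label g = Label.or) :
    c.eval w g ↔ ∃ h, c.wire g h ∧ c.eval w h := by
  rw [eval_iff, hg]

theorem eval_of_label_not (hg : c.label g = Label.not) :
    c.eval w g ↔ ∃ h, c.wire g h ∧ ¬ c.eval w h := by
  rw [eval_iff, hg]

theorem eval_of_label_input {i : Fin n} {a : A} (hg : c.label g = Label.input i a) :
    c.eval w g ↔ w i = a := by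
  rw [eval_iff, hg]

end Circuit

/-- How a gate named by a tuple `v` of `k` numbers gets its label: a NOT-gate; an AND-gate if `φ`
holds at `v` and an OR-gate otherwise; or a test for the letter `a` at position `v i`. -/
inductive GateRule (A : Type) (k : ℕ) : Type
  | not
  | andOr (φ : numLang.Formula (Fin k))
  | letter (a : A) (i : Fin k)

namespace GateRule

variable {A : Type} {k : ℕ}

open Classical in
/-- The label that a rule gives to the gate named by `v`. The last position `n` carries no letter,
and a test there is an OR-gate, which is false for lack of inputs. -/
noncomputable def label {n : ℕ} : GateRule A k → (Fin k → Fin (n + 1)) → Label A n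
  | not, _ => .not
  | andOr φ, v => if φ.Realize v then .and else .or
  | letter a i, v => if h : (v i : ℕ) < n then .input ⟨v i, h⟩ a else .or

theorem uniformlyDefinable_label_eq_and (r : GateRule A k) :
    UniformlyDefinable fun n (v : Fin k → Fin (n + 1)) => r.label v = Label.and :=
  match r with
  | not => (UniformlyDefinable.const False).congr fun n v => by simp [label]
  | andOr φ => ⟨φ, fun n v => by simp [label]⟩
  | letter a i => (UniformlyDefinable.const False).congr fun n v => by
      simp only [label]; split_ifs <;> simp

theorem uniformlyDefinable_label_eq_or (r : GateRule A k) :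
    UniformlyDefinable fun n (v : Fin k → Fin (n + 1)) => r.label v = Label.or :=
  match r with
  | not => (UniformlyDefinable.const False).congr fun n v => by simp [label]
  | andOr φ => ⟨φ.not, fun n v => by simp [label]⟩
  | letter a i => (UniformlyDefinable.lt_last i).not.congr fun n v => by
      simp only [label]; split_ifs with h <;> simp [h]

theorem label_eq_not_iff {n : ℕ} (r : GateRule A k) (v : Fin k → Fin (n + 1)) :
    r.label v = Label.not ↔ r = not := by
  cases r <;> simp only [label] <;> split_ifs <;> simp

theorem label_eq_input_iff {n : ℕ} (r : GateRule A k) (v : Fin k → Fin (n + 1)) (p : Fin n)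
    (a : A) : r.label v = Label.input p a ↔ ∃ i, r = letter a i ∧ (v i : ℕ) = p := by
  cases r with
  | not => simp [label]
  | andOr φ => simp only [label]; split_ifs <;> simp
  | letter b i =>
    simp only [label]
    split_ifs with h
    · rw [Label.input.injEq, Fin.ext_iff]
      exact ⟨fun ⟨hp, hb⟩ => ⟨i, hb ▸ rfl, hp⟩,
        fun ⟨j, hj, hp⟩ => by obtain ⟨rfl, rfl⟩ := letter.inj hj; exact ⟨hp, rfl⟩⟩
    · simp only [letter.injEq, false_iff]
      rintro ⟨j, ⟨-, rfl⟩, hj⟩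
      exact h (hj ▸ p.2)

theorem uniformlyDefinable_label_eq_input (r : GateRule A k) (a : A) :
    UniformlyDefinable fun n (v : Fin k ⊕ Unit → Fin (n + 1)) =>
      ∃ p, r.label (fun j => v (Sum.inl j)) = Label.input p a ∧ (v (Sum.inr ()) : ℕ) = p := by
  have hletter (i : Fin k) : UniformlyDefinable fun n (v : Fin k ⊕ Unit → Fin (n + 1)) =>
      ¬ (r = letter a i ∧ (v (Sum.inl i) : ℕ) < n ∧ v (Sum.inr ()) = v (Sum.inl i)) :=
    ((UniformlyDefinable.const _).and ((UniformlyDefinable.lt_last _).and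
      (UniformlyDefinable.eq _ _))).not
  refine (UniformlyDefinable.forall_finite hletter).not.congr fun n v => ?_
  simp only [not_forall, not_not, label_eq_input_iff, Fin.ext_iff]
  exact ⟨fun ⟨i, hr, hi, hv⟩ => ⟨⟨v (Sum.inl i), hi⟩, ⟨i, hr, rfl⟩, hv⟩,
    fun ⟨p, ⟨i, hr, hp⟩, hv⟩ => ⟨i, hr, hp ▸ p.2, hv.trans hp.symm⟩⟩

end GateRule

/-- A description, uniform in the word length `n`, of a circuit whose gates are the pairs of a tag
and a `k`-tuple of numbers at most `n`. A gate `(s, v)` reads the gates `(t, u)` with `Input s t`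
such that `u` agrees with `v` outside the coordinates `bound s`. -/
structure CircuitScheme (A : Type) (k : ℕ) where
  Tag : Type
  finite_tag : Finite Tag
  rule : Tag → GateRule A k
  Input : Tag → Tag → Prop
  bound : Tag → Set (Fin k)
  out : Tag
  height : Tag → ℕ
  height_lt : ∀ s t, Input s t → height t < height s
  existsUnique_input : ∀ s, rule s = GateRule.not → bound s = ∅ ∧ ∃! t, Input s t
  not_input : ∀ s a i, rule s = GateRule.letter a i → ∀ t, ¬ Input s t

namespace CircuitScheme

variable {A : Type} {k : ℕ} (C : CircuitScheme A k)

/-- The circuit for words of length `n` described by a scheme. -/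
noncomputable def circuit (n : ℕ) : Circuit A n where
  Gate := C.Tag × (Fin k → Fin (n + 1))
  finite_gate := by
    have := C.finite_tag
    infer_instance
  label g := (C.rule g.1).label g.2
  wire g h := C.Input g.1 h.1 ∧ ∀ j ∉ C.bound g.1, h.2 j = g.2 j
  out := (C.out, 0)
  acyclic := Subrelation.wf (fun h => C.height_lt _ _ h.1)
    (InvImage.wf (fun g : C.Tag × (Fin k → Fin (n + 1)) => C.height g.1) wellFounded_lt)
  not_fanin := by
    rintro ⟨s, v⟩ hs
    obtain ⟨hb, t, ht, huniq⟩ := C.existsUnique_input s ((GateRule.label_eq_not_iff _ v).1 hs)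
    refine ⟨(t, v), ⟨ht, fun _ _ => rfl⟩, ?_⟩
    rintro ⟨t', u⟩ ⟨ht', hu⟩
    exact Prod.ext (huniq t' ht') (funext fun j => hu j (by simp [hb]))
  input_fanin := by
    rintro ⟨s, v⟩ p a hs ⟨t, u⟩ ⟨ht, -⟩
    obtain ⟨i, hi, -⟩ := (GateRule.label_eq_input_iff _ v p a).1 hs
    exact C.not_input s a i hi t ht

theorem depthLE_circuit : ∃ d, ∀ n, (C.circuit n).DepthLE d := by
  have := C.finite_tag
  obtain ⟨d, hd⟩ := (Set.finite_range C.height).bddAbove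
  exact ⟨d, fun n => ⟨fun g => C.height g.1, fun g h hgh => C.height_lt _ _ hgh.1,
    fun g => hd ⟨g.1, rfl⟩⟩⟩

theorem size_circuit (n : ℕ) : (C.circuit n).size = Nat.card C.Tag * (n + 1) ^ k := by
  refine (Nat.card_prod C.Tag (Fin k → Fin (n + 1))).trans ?_
  simp

theorem foUniform_circuit : FOUniform C.circuit := by
  have := C.finite_tag
  obtain ⟨t, ⟨e⟩⟩ := Finite.exists_equiv_fin C.Tag
  have name_eq {n : ℕ} {g : C.Tag × (Fin k → Fin (n + 1))} {τ : Fin t} {v : Fin k → Fin (n + 1)} :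
      (e g.1, g.2) = (τ, v) ↔ g = (e.symm τ, v) := by
    rw [Prod.mk.injEq, Prod.ext_iff, Equiv.eq_symm_apply]
  have of_rule (τ : Fin t) {P : ∀ n, C.Tag × (Fin k → Fin (n + 1)) → Prop}
      (h : UniformlyDefinable fun n v => P n (e.symm τ, v)) :
      UniformlyDefinable fun n v => ∃ g : C.Tag × (Fin k → Fin (n + 1)),
        (e g.1, g.2) = (τ, v) ∧ P n g :=
    h.congr fun n v => by simp only [name_eq, exists_eq_left]
  refine ⟨t, k, fun n g => (e g.1, g.2), fun n g g' h => ?_, fun τ => ?_, fun τ => ?_,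
    fun τ => of_rule τ (C.rule (e.symm τ)).uniformlyDefinable_label_eq_and,
    fun τ => of_rule τ (C.rule (e.symm τ)).uniformlyDefinable_label_eq_or,
    fun τ => of_rule τ ?_, fun τ a => ?_, fun τ τ' => ?_⟩
  · exact Prod.ext (e.injective (congrArg Prod.fst h)) (congrArg Prod.snd h :)
  · exact (UniformlyDefinable.const True).congr fun n v =>
      iff_of_true trivial ⟨(e.symm τ, v), name_eq.2 rfl⟩
  · refine ((UniformlyDefinable.const (e C.out = τ)).and
      (UniformlyDefinable.forall_finite UniformlyDefinable.eq_zero)).congr fun n v => ?_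
    simp only [circuit, Prod.mk.injEq, eq_comm (b := v), funext_iff, Pi.zero_apply]
  · exact (UniformlyDefinable.const (C.rule (e.symm τ) = GateRule.not)).congr fun n v =>
      (GateRule.label_eq_not_iff _ v).symm
  · exact ((C.rule (e.symm τ)).uniformlyDefinable_label_eq_input a).congr fun n v => by
      simp only [circuit, name_eq, exists_and_left, exists_eq_left]
  · refine ((UniformlyDefinable.const (C.Input (e.symm τ) (e.symm τ'))).and
      (UniformlyDefinable.forall_finite fun j : {j // j ∉ C.bound (e.symm τ)} =>
        UniformlyDefinable.eq (Sum.inr j.1) (Sum.inl j.1))).congr fun n v => ?_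
    simp only [circuit, name_eq, exists_and_left, exists_eq_left, Subtype.forall]

variable {C} {l : List A} {s : C.Tag} {v : Fin k → Fin (l.length + 1)}

variable (C l) in
/-- The value on the word `l` of the gate named by the tag `s` and the tuple `v`. -/
def Eval (s : C.Tag) (v : Fin k → Fin (l.length + 1)) : Prop :=
  (C.circuit l.length).eval l.get (s, v)

theorem eval_not {t : C.Tag} (hs : C.rule s = GateRule.not) (hst : C.Input s t) :
    C.Eval l s v ↔ ¬ C.Eval l t v := by
  have hlabel : (C.rule s).label v = Label.not := (GateRule.label_eq_not_iff _ v).2 hs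
  obtain ⟨g, -, hg⟩ := (C.circuit l.length).not_fanin (s, v) hlabel
  have hwire : (C.circuit l.length).wire (s, v) (t, v) := ⟨hst, fun _ _ => rfl⟩
  refine (Circuit.eval_of_label_not hlabel).trans ⟨fun ⟨h, hw, he⟩ => ?_, fun h => ⟨_, hwire, h⟩⟩
  rwa [hg h hw, ← hg _ hwire] at he

theorem eval_and {φ : numLang.Formula (Fin k)} (hs : C.rule s = GateRule.andOr φ)
    (hφ : φ.Realize v) :
    C.Eval l s v ↔ ∀ t u, C.Input s t → (∀ j ∉ C.bound s, u j = v j) → C.Eval l t u := by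
  have hlabel : (C.rule s).label v = Label.and := by simp only [hs, GateRule.label, if_pos hφ]
  exact (Circuit.eval_of_label_and hlabel).trans
    ⟨fun h t u ht hu => h (t, u) ⟨ht, hu⟩, fun h g hg => h g.1 g.2 hg.1 hg.2⟩

theorem eval_or {φ : numLang.Formula (Fin k)} (hs : C.rule s = GateRule.andOr φ)
    (hφ : ¬ φ.Realize v) :
    C.Eval l s v ↔ ∃ t u, C.Input s t ∧ (∀ j ∉ C.bound s, u j = v j) ∧ C.Eval l t u := by
  have hlabel : (C.rule s).label v = Label.or := by simp only [hs, GateRule.label, if_neg hφ]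
  exact (Circuit.eval_of_label_or hlabel).trans
    ⟨fun ⟨g, hg, he⟩ => ⟨g.1, g.2, hg.1, hg.2, he⟩,
      fun ⟨t, u, ht, hu, he⟩ => ⟨(t, u), ⟨ht, hu⟩, he⟩⟩

theorem eval_letter {a : A} {i : Fin k} (hs : C.rule s = GateRule.letter a i) :
    C.Eval l s v ↔ l[(v i : ℕ)]? = some a := by
  by_cases h : (v i : ℕ) < l.length
  · have hlabel : (C.rule s).label v = Label.input ⟨v i, h⟩ a :=
      (GateRule.label_eq_input_iff _ v _ a).2 ⟨i, hs, rfl⟩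
    exact (Circuit.eval_of_label_input hlabel).trans (by simp [h])
  · have hlabel : (C.rule s).label v = Label.or := by simp only [hs, GateRule.label, dif_neg h]
    rw [List.getElem?_eq_none (not_lt.1 h)]
    exact (Circuit.eval_of_label_or hlabel).trans
      (iff_of_false (fun ⟨g, hg, _⟩ => C.not_input s a i hs g.1 hg.1) nofun)

theorem inAC0 [Finite A] {L : Language A} (hL : ∀ l : List A, C.Eval l C.out 0 ↔ l ∈ L) :
    InAC0 L := by
  refine ⟨C.circuit, C.depthLE_circuit,
    ⟨.C (Nat.card C.Tag) * (.X + 1) ^ k, fun n => (C.size_circuit n).le.trans (by simp)⟩,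
    C.foUniform_circuit, fun n w => ?_⟩
  have accepts_iff : ∀ x : Σ n, Fin n → A, (C.circuit x.1).Accepts x.2 ↔ List.ofFn x.2 ∈ L :=
    List.equivSigmaTuple.surjective.forall.2 fun l =>
      (hL l).trans (iff_of_eq (congrArg (· ∈ L) (List.ofFn_get l).symm))
  exact accepts_iff ⟨n, w⟩

end CircuitScheme

/-! ### First-order logic on words -/

/-- The relation symbols of the logic on words over `A`: those of bounded arithmetic, and a
predicate for each letter. -/
inductive WordRel (A : Type) : ℕ → Type
  | num {k : ℕ} (r : NumRel k) : WordRel A k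
  | letter (a : A) : WordRel A 1

/-- The language of first-order logic on words over `A` with order, addition and multiplication. -/
def wordLang (A : Type) : FirstOrder.Language := ⟨fun _ => Empty, WordRel A⟩

/-- The positions `0, …, l.length` of a word `l`; the last one carries no letter. -/
abbrev Position {A : Type} (l : List A) : Type := Fin (l.length + 1)

instance wordStructure {A : Type} (l : List A) : (wordLang A).Structure (Position l) where
  funMap f _ := f.elim
  RelMap r v :=
    match r with
    | .num r => Structure.RelMap (L := numLang) r v
    | .letter a => l[(v 0 : ℕ)]? = some a

/-- The variable that a term is: the language has no function symbols. -/
def termVar {A α : Type} : (wordLang A).Term α → α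
  | .var x => x
  | .func f _ => f.elim

theorem realize_eq_termVar {A α : Type} {l : List A} (t : (wordLang A).Term α)
    (v : α → Position l) : t.realize v = v (termVar t) :=
  match t with
  | .var _ => rfl
  | .func f _ => f.elim

/-- A gate type of the circuit that evaluates a formula: the value of a subformula or its
negation. -/
inductive FormulaGate (A : Type) : Type
  | pos {m : ℕ} (φ : (wordLang A).BoundedFormula Empty m)
  | neg {m : ℕ} (φ : (wordLang A).BoundedFormula Empty m)

namespace FormulaGate

variable {A : Type}

/-- The gates read by a gate, where `φ ⟹ ψ` is evaluated as `¬ φ ∨ ψ`. -/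
def inputs : FormulaGate A → List (FormulaGate A)
  | pos (.imp φ ψ) => [neg φ, pos ψ]
  | pos (.all φ) => [pos φ]
  | pos _ => []
  | neg φ => [pos φ]

/-- The number of variables in scope. -/
def scope : FormulaGate A → ℕ
  | pos (m := m) _ => m
  | neg (m := m) _ => m

/-- A bound on the lengths of the paths of wires to a gate. -/
noncomputable def height : FormulaGate A → ℕ
  | pos φ => 2 * sizeOf φ
  | neg φ => 2 * sizeOf φ + 1

theorem height_lt {x y : FormulaGate A} (h : x ∈ y.inputs) : x.height < y.height := by
  rcases y with ⟨φ⟩ | φ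
  · cases φ <;> simp only [inputs, List.mem_cons, List.not_mem_nil, or_false] at h
    · rcases h with rfl | rfl <;> simp only [height, imp.sizeOf_spec] <;> omega
    · subst h; simp only [height, all.sizeOf_spec]; omega
  · simp only [inputs, List.mem_singleton] at h
    subst h; simp only [height]; omega

/-- The variable of index `i` among the `k + 1` coordinates of gate names; a gate whose scope is
at most `k + 1` uses the first ones. -/
abbrev coord (k i : ℕ) : Fin (k + 1) := Fin.ofNat (k + 1) i

theorem coord_ne {k i j : ℕ} (hij : i < j) (hj : j ≤ k) : coord k i ≠ coord k j := by
  simp only [ne_eq, Fin.ext_iff, Fin.val_ofNat]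
  rw [Nat.mod_eq_of_lt (by omega), Nat.mod_eq_of_lt (by omega)]
  exact hij.ne

/-- The coordinate of the variable that a gate quantifies over. -/
def bound (k : ℕ) : FormulaGate A → Set (Fin (k + 1))
  | pos (.all (n := m) _) => {coord k m}
  | _ => ∅

/-- The coordinate of the variable that a term is. -/
def var (k : ℕ) {m : ℕ} (t : (wordLang A).Term (Empty ⊕ Fin m)) : Fin (k + 1) :=
  coord k (Sum.elim Empty.elim Fin.val (termVar t))

/-- The rules of the gates of a formula. Equations and arithmetical atoms do not read the word: as
gates without inputs they are AND-gates where true and OR-gates where false. -/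
def rule (k : ℕ) : FormulaGate A → GateRule A (k + 1)
  | pos .falsum => .andOr ⊥
  | pos (.equal t u) => .andOr (Term.equal (.var (var k t)) (.var (var k u)))
  | pos (.rel (.num r) ts) =>
      .andOr (Relations.formula (L := numLang) r fun i => .var (var k (ts i)))
  | pos (.rel (.letter a) ts) => .letter a (var k (ts 0))
  | pos (.imp _ _) => .andOr ⊥
  | pos (.all _) => .andOr ⊤
  | neg _ => .not

theorem inputs_eq_nil_of_rule_eq_letter {k : ℕ} {x : FormulaGate A} {a : A} {i : Fin (k + 1)}
    (h : x.rule k = .letter a i) : x.inputs = [] := by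
  match x, h with
  | pos (.rel (.letter _) _), _ => rfl
  | pos (.rel (.num _) _), _ => rfl

theorem eq_neg_of_rule_eq_not {k : ℕ} {x : FormulaGate A} (h : x.rule k = .not) :
    ∃ m, ∃ φ : (wordLang A).BoundedFormula Empty m, x = neg φ := by
  match x, h with
  | neg φ, _ => exact ⟨_, φ, rfl⟩
  | pos (.rel (.letter _) _), h => cases h
  | pos (.rel (.num _) _), h => cases h

/-- The gate `y` is read, directly or indirectly, by the gate `x`. -/
abbrev Reaches (y x : FormulaGate A) : Prop :=
  Relation.ReflTransGen (· ∈ inputs ·) y x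

theorem finite_setOf_reaches (x : FormulaGate A) : {y | Reaches y x}.Finite :=
  finite_setOf_reflTransGen (Subrelation.wf height_lt (InvImage.wf height wellFounded_lt))
    (fun y => y.inputs.finite_toSet) x

/-- The scheme of the circuits that evaluate the gate `x` with `k + 1` coordinates. -/
noncomputable def scheme (x : FormulaGate A) (k : ℕ) : CircuitScheme A (k + 1) where
  Tag := {y // Reaches y x}
  finite_tag := finite_setOf_reaches x
  rule y := y.1.rule k
  Input y z := z.1 ∈ y.1.inputs
  bound y := y.1.bound k
  out := ⟨x, .refl⟩
  height y := y.1.height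
  height_lt _ _ h := height_lt h
  existsUnique_input := by
    rintro ⟨y, hy⟩ h
    obtain ⟨m, φ, rfl⟩ := eq_neg_of_rule_eq_not h
    refine ⟨rfl, ⟨pos φ, .head (List.mem_singleton_self _) hy⟩, List.mem_singleton_self _,
      fun z hz => Subtype.ext (List.mem_singleton.1 hz)⟩
  not_input y a i h z hz := by
    rw [inputs_eq_nil_of_rule_eq_letter h] at hz
    exact List.not_mem_nil hz

theorem realize_term {k m : ℕ} {l : List A} (t : (wordLang A).Term (Empty ⊕ Fin m))
    (v : Fin (k + 1) → Position l) :
    t.realize (Sum.elim default fun i : Fin m => v (coord k i)) = v (var k t) := by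
  rw [realize_eq_termVar, var]
  rcases termVar t with x | i
  · exact x.elim
  · rfl

variable {x : FormulaGate A} {k m : ℕ} {l : List A} {v : Fin (k + 1) → Position l}
  {φ ψ : (wordLang A).BoundedFormula Empty m}

/-- The value of the gate `y` with coordinates `v` in the circuit that evaluates `x`. -/
def Value {y : FormulaGate A} (h : Reaches y x) (v : Fin (k + 1) → Position l) : Prop :=
  (x.scheme k).Eval l ⟨y, h⟩ v

theorem value_neg {h : Reaches (neg φ) x} {hφ : Reaches (pos φ) x} :
    Value h v ↔ ¬ Value hφ v :=
  CircuitScheme.eval_not (C := x.scheme k) rfl (List.mem_singleton_self (pos φ))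

theorem value_imp {h : Reaches (pos (φ.imp ψ)) x} {hφ : Reaches (pos φ) x}
    {hψ : Reaches (pos ψ) x} : Value h v ↔ (Value hφ v → Value hψ v) := by
  have hneg : Reaches (neg φ) x := .head (List.mem_cons_self (l := [pos ψ])) h
  refine (CircuitScheme.eval_or (C := x.scheme k) rfl id).trans ?_
  rw [imp_iff_not_or, ← value_neg (h := hneg)]
  constructor
  · rintro ⟨⟨y, hy⟩, u, hyx, hu, he⟩
    obtain rfl : u = v := funext fun j => hu j (Set.notMem_empty j)
    rcases List.mem_pair.1 hyx with rfl | rfl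
    exacts [.inl he, .inr he]
  · rintro (he | he)
    exacts [⟨⟨_, hneg⟩, v, List.mem_pair.2 (.inl rfl), fun _ _ => rfl, he⟩,
      ⟨⟨_, hψ⟩, v, List.mem_pair.2 (.inr rfl), fun _ _ => rfl, he⟩]

theorem value_all {φ : (wordLang A).BoundedFormula Empty (m + 1)} {h : Reaches (pos φ.all) x}
    {hφ : Reaches (pos φ) x} :
    Value h v ↔ ∀ p, Value hφ (Function.update v (coord k m) p) := by
  refine (CircuitScheme.eval_and (C := x.scheme k) rfl id).trans ⟨fun he p => ?_, ?_⟩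
  · exact he ⟨_, hφ⟩ _ (List.mem_singleton_self (pos φ))
      fun j hj => Function.update_of_ne hj _ _
  · rintro he ⟨y, hy⟩ u hyx hu
    obtain rfl := List.mem_singleton.1 hyx
    have hupdate : Function.update v (coord k m) (u (coord k m)) = u :=
      Function.update_eq_iff.2 ⟨rfl, fun j hj => (hu j hj).symm⟩
    exact hupdate ▸ he (u (coord k m))

theorem value_of_inputs_eq_nil {y : FormulaGate A} {h : Reaches y x} (hy : y.inputs = [])
    {θ : numLang.Formula (Fin (k + 1))} (hθ : y.rule k = .andOr θ) : Value h v ↔ θ.Realize v := by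
  have not_input {z : FormulaGate A} (hz : z ∈ y.inputs) : False := by
    rw [hy] at hz; exact List.not_mem_nil hz
  by_cases hv : θ.Realize v
  · exact iff_of_true ((CircuitScheme.eval_and (C := x.scheme k) (s := ⟨y, h⟩) hθ hv).2
      fun z _ hz => (not_input hz).elim) hv
  · exact iff_of_false (fun he => have ⟨_, _, hz, _⟩ :=
      (CircuitScheme.eval_or (C := x.scheme k) (s := ⟨y, h⟩) hθ hv).1 he; not_input hz) hv

theorem value_iff_realize (hk : ∀ y, Reaches y x → y.scope ≤ k) {m : ℕ}
    (φ : (wordLang A).BoundedFormula Empty m) (h : Reaches (pos φ) x)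
    (v : Fin (k + 1) → Position l) :
    Value h v ↔ φ.Realize default fun i => v (coord k i) := by
  induction φ generalizing v with
  | falsum => exact value_of_inputs_eq_nil (h := h) rfl rfl
  | equal t u =>
    refine (value_of_inputs_eq_nil (h := h) rfl rfl).trans ?_
    simp only [BoundedFormula.Realize, realize_term]
    exact Formula.realize_equal
  | rel r ts =>
    cases r with
    | num r =>
      refine (value_of_inputs_eq_nil (h := h) rfl rfl).trans
        (Formula.realize_rel.trans ?_)
      simp only [BoundedFormula.Realize, realize_term]
      exact Iff.rfl
    | letter a =>
      simp only [BoundedFormula.Realize, realize_term]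
      exact CircuitScheme.eval_letter (C := x.scheme k) rfl
  | imp φ ψ ihφ ihψ =>
    have hneg : Reaches (neg φ) x := .head (List.mem_pair.2 (.inl rfl)) h
    have hφ : Reaches (pos φ) x := .head (List.mem_singleton_self _) hneg
    have hψ : Reaches (pos ψ) x := .head (List.mem_pair.2 (.inr rfl)) h
    rw [value_imp (hφ := hφ) (hψ := hψ), ihφ, ihψ, realize_imp]
  | @all m φ ih =>
    have hφ : Reaches (pos φ) x := .head (List.mem_singleton_self _) h
    have hm : m ≤ k := hk _ h
    have update_coord (p : Position l) : (fun i : Fin (m + 1) =>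
        Function.update v (coord k m) p (coord k i)) = Fin.snoc (fun i => v (coord k i)) p := by
      funext i
      refine i.lastCases ?_ fun i => ?_
      · rw [Fin.snoc_last, Fin.val_last, Function.update_self]
      · rw [Fin.snoc_castSucc]
        exact Function.update_of_ne (coord_ne i.2 hm) _ _
    simp only [value_all (hφ := hφ), ih, update_coord, realize_all]

end FormulaGate

theorem inAC0_of_forall_realize_iff_mem {A : Type} [Finite A] (φ : (wordLang A).Sentence)
    {L : Language A} (hφ : ∀ l : List A, Position l ⊨ φ ↔ l ∈ L) : InAC0 L := by
  obtain ⟨k, hk⟩ := ((FormulaGate.finite_setOf_reaches (.pos φ)).image FormulaGate.scope).bddAbove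
  refine ((FormulaGate.pos φ).scheme k).inAC0 fun l => Iff.trans ?_ (hφ l)
  refine (FormulaGate.value_iff_realize (fun y hy => hk ⟨y, hy, rfl⟩) φ .refl 0).trans ?_
  exact iff_of_eq
    (congrArg₂ (BoundedFormula.Realize φ) (Subsingleton.elim _ _) (Subsingleton.elim _ _))

/-- A relation between words and tuples of positions in them is defined by one first-order formula
on words. Positions are passed as natural numbers; only the values of `P` at positions
`0, …, l.length` matter. -/
def Definable {A ι : Type} (P : List A → (ι → ℕ) → Prop) : Prop :=
  ∃ φ : (wordLang A).Formula ι, ∀ (l : List A) (v : ι → Position l),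
    φ.Realize v ↔ P l fun i => v i

/-- The graph of a function of words and positions in them is first-order definable. -/
def DefinableNat {A ι : Type} (F : List A → (ι → ℕ) → ℕ) : Prop :=
  Definable fun l (v : Option ι → ℕ) => v none = F l fun i => v (some i)

namespace Definable

variable {A ι κ : Type} {P Q : List A → (ι → ℕ) → Prop}

theorem inAC0 [Finite A] {L : Language A} (hL : Definable fun l (_ : Empty → ℕ) => l ∈ L) :
    InAC0 L :=
  let ⟨φ, hφ⟩ := hL
  inAC0_of_forall_realize_iff_mem φ fun l => hφ l _

theorem congr (hP : Definable P) (h : ∀ l v, (∀ i, v i ≤ l.length) → (P l v ↔ Q l v)) :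
    Definable Q :=
  let ⟨φ, hφ⟩ := hP
  ⟨φ, fun l v => (hφ l v).trans (h l _ fun i => Nat.le_of_lt_succ (v i).2)⟩

theorem comp (hP : Definable P) (f : ι → κ) :
    Definable fun l (v : κ → ℕ) => P l fun i => v (f i) :=
  let ⟨φ, hφ⟩ := hP
  ⟨φ.relabel f, fun l v => Formula.realize_relabel.trans (hφ l (v ∘ f))⟩

theorem not (hP : Definable P) : Definable fun l v => ¬ P l v :=
  let ⟨φ, hφ⟩ := hP
  ⟨φ.not, fun l v => (hφ l v).not⟩

theorem and (hP : Definable P) (hQ : Definable Q) : Definable fun l v => P l v ∧ Q l v :=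
  let ⟨φ, hφ⟩ := hP
  let ⟨ψ, hψ⟩ := hQ
  ⟨φ ⊓ ψ, fun l v => Formula.realize_inf.trans ((hφ l v).and (hψ l v))⟩

theorem or (hP : Definable P) (hQ : Definable Q) : Definable fun l v => P l v ∨ Q l v :=
  (hP.not.and hQ.not).not.congr fun _ _ _ => by tauto

theorem imp (hP : Definable P) (hQ : Definable Q) : Definable fun l v => P l v → Q l v :=
  (hP.and hQ.not).not.congr fun _ _ _ => by tauto

theorem iff (hP : Definable P) (hQ : Definable Q) : Definable fun l v => (P l v ↔ Q l v) :=
  ((hP.imp hQ).and (hQ.imp hP)).congr fun _ _ _ => iff_def.symm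

theorem const (p : Prop) : Definable fun (_ : List A) (_ : ι → ℕ) => p := by
  by_cases hp : p
  · exact ⟨⊤, fun l v => by simp [hp]⟩
  · exact ⟨⊥, fun l v => by simp [hp]⟩

section Finite

variable {β : Type} {R : β → List A → (ι → ℕ) → Prop}

theorem exists_mem (bs : List β) (hR : ∀ b, Definable (R b)) :
    Definable fun l v => ∃ b ∈ bs, R b l v := by
  induction bs with
  | nil => exact (const False).congr fun l v _ => by simp
  | cons b bs ih => exact ((hR b).or ih).congr fun l v _ => by simp

theorem forall_mem (bs : List β) (hR : ∀ b, Definable (R b)) :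
    Definable fun l v => ∀ b ∈ bs, R b l v :=
  (exists_mem bs fun b => (hR b).not).not.congr fun l v _ => by simp

theorem exists_finite [Finite β] (hR : ∀ b, Definable (R b)) :
    Definable fun l v => ∃ b, R b l v := by
  have := Fintype.ofFinite β
  exact (exists_mem Finset.univ.toList hR).congr fun l v _ => by simp

theorem forall_finite [Finite β] (hR : ∀ b, Definable (R b)) :
    Definable fun l v => ∀ b, R b l v :=
  (exists_finite fun b => (hR b).not).not.congr fun l v _ => by simp

end Finite

theorem exists_tuple [Finite κ] {P : List A → (ι → ℕ) → (κ → ℕ) → Prop}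
    (hP : Definable fun l (v : ι ⊕ κ → ℕ) => P l (fun i => v (.inl i)) fun j => v (.inr j)) :
    Definable fun l v => ∃ u : κ → Position l, P l v fun j => u j :=
  let ⟨φ, hφ⟩ := hP
  ⟨φ.iExs κ, fun l v => (Formula.realize_iExs (φ := φ)).trans
    (exists_congr fun u => hφ l (Sum.elim v u))⟩

section Quantifier

variable {P : List A → (ι → ℕ) → ℕ → Prop}
  (hP : Definable fun l (v : Option ι → ℕ) => P l (fun i => v (some i)) (v none))

include hP

theorem exists_le : Definable fun l v => ∃ x ≤ l.length, P l v x := by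
  refine (exists_tuple (κ := Unit) (P := fun l v u => P l v (u ())) <|
    hP.comp fun o : Option ι => o.elim (Sum.inr ()) Sum.inl).congr fun l v _ => ?_
  refine ⟨fun ⟨u, hu⟩ => ⟨u (), Nat.le_of_lt_succ (u ()).2, hu⟩, fun ⟨x, hx, h⟩ => ?_⟩
  exact ⟨fun _ => ⟨x, Nat.lt_succ_of_le hx⟩, h⟩

theorem forall_le : Definable fun l v => ∀ x ≤ l.length, P l v x :=
  (exists_le (P := fun l v x => ¬ P l v x) hP.not).not.congr fun l v _ => by simp

theorem subst {F : List A → (ι → ℕ) → ℕ} (hF : DefinableNat F)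
    (hle : ∀ l v, (∀ i, v i ≤ l.length) → P l v (F l v) → F l v ≤ l.length) :
    Definable fun l v => P l v (F l v) := by
  refine (exists_le (P := fun l v x => x = F l v ∧ P l v x) (hF.and hP)).congr fun l v hv => ?_
  refine ⟨?_, fun h => ⟨_, hle l v hv h, rfl, h⟩⟩
  rintro ⟨_, _, rfl, h⟩
  exact h

end Quantifier

theorem le (i j : ι) : Definable fun (_ : List A) v => v i ≤ v j :=
  ⟨Relations.formula₂ (L := wordLang A) (WordRel.num .le) (.var i) (.var j),
    fun _ _ => Formula.realize_rel₂⟩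

theorem lt (i j : ι) : Definable fun (_ : List A) v => v i < v j :=
  (le j i).not.congr fun _ _ _ => not_le

theorem letter (a : A) (i : ι) : Definable fun l v => l[v i]? = some a :=
  ⟨Relations.formula₁ (L := wordLang A) (WordRel.letter a) (.var i),
    fun _ _ => Formula.realize_rel₁⟩

end Definable

namespace DefinableNat

variable {A ι κ : Type}

theorem add (i j : ι) : DefinableNat fun (_ : List A) v => v i + v j :=
  ⟨Relations.formula (L := wordLang A) (WordRel.num .add)
      ![.var (some i), .var (some j), .var none],
    fun _ _ => Formula.realize_rel.trans eq_comm⟩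

theorem succ (i : ι) : DefinableNat fun (_ : List A) v => v i + 1 := by
  have hlt : Definable fun (_ : List A) (v : Option ι → ℕ) => v (some i) < v none := .lt _ _
  refine (hlt.and (.forall_le (P := fun _ v x => v (some i) < x → v none ≤ x)
    ((Definable.lt _ _).imp (.le _ _)))).congr fun l v hv => ?_
  refine ⟨fun ⟨h, hmin⟩ => ?_, fun h => ⟨Nat.succ_le_iff.1 h.ge, fun x _ hx => h.trans_le hx⟩⟩
  exact (hmin _ (Nat.succ_le_of_lt (h.trans_le (hv none))) (Nat.lt_succ_self _)).antisymm h

theorem const (c : ℕ) : DefinableNat fun (_ : List A) (_ : ι → ℕ) => c := by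
  induction c generalizing ι with
  | zero =>
    refine Definable.congr (.forall_le (P := fun _ v x => v none ≤ x) (.le _ _)) fun l v _ => ?_
    exact ⟨fun h => Nat.le_zero.1 (h 0 (Nat.zero_le _)), fun h x _ => h.trans_le (Nat.zero_le x)⟩
  | succ c ih =>
    have hsucc : Definable fun (_ : List A) (v : Option (Option ι) → ℕ) =>
        v (some none) = v none + 1 :=
      Definable.comp (succ none) (fun o : Option (Option Unit) => o.elim (some none) fun _ => none)
    exact .subst (P := fun _ v x => v none = x + 1) hsucc ih fun l v hv h =>
      (Nat.le_succ c).trans (h.ge.trans (hv none))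

end DefinableNat

end Circuits

/-! ### Reading encoded databases -/

variable {σ : Schema}

section Constants

/-- The longest bit string with which a word begins. -/
def leadingBits : List (Letter σ) → Const
  | .bit b :: l => b :: leadingBits l
  | _ => []

theorem leadingBits_drop_length : ∀ l : List (Letter σ),
    leadingBits (l.drop (leadingBits l).length) = []
  | [] => rfl
  | .bit _ :: l => leadingBits_drop_length l
  | .sep :: _ | .sign _ :: _ | .rel _ :: _ => rfl

theorem map_leadingBits_append_drop : ∀ l : List (Letter σ),
    (leadingBits l).map .bit ++ l.drop (leadingBits l).length = l
  | [] => rfl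
  | .bit b :: l => congrArg (Letter.bit b :: ·) (map_leadingBits_append_drop l)
  | .sep :: _ | .sign _ :: _ | .rel _ :: _ => rfl

theorem leadingBits_map_append (c : Const) {l : List (Letter σ)} (hl : leadingBits l = []) :
    leadingBits (c.map .bit ++ l) = c := by
  induction c with
  | nil => exact hl
  | cons b c ih => exact congrArg (b :: ·) ih

/-- The constant whose bits are written from position `x` on. -/
def constAt (l : List (Letter σ)) (x : ℕ) : Const :=
  leadingBits (l.drop x)

/-- The position after the last bit of the constant written from position `x` on. -/
def constEnd (l : List (Letter σ)) (x : ℕ) : ℕ :=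
  x + (constAt l x).length

/-- The letter at position `x` is a bit. -/
def IsBitAt (l : List (Letter σ)) (x : ℕ) : Prop :=
  ∃ b, l[x]? = some (.bit b)

theorem map_constAt_append_drop (l : List (Letter σ)) (x : ℕ) :
    (constAt l x).map .bit ++ l.drop (constEnd l x) = l.drop x := by
  rw [constEnd, ← List.drop_drop]
  exact map_leadingBits_append_drop _

theorem constEnd_le {l : List (Letter σ)} {x : ℕ} (hx : x ≤ l.length) :
    constEnd l x ≤ l.length := by
  have h := congrArg List.length (map_constAt_append_drop l x)
  rw [List.length_append, List.length_map, List.length_drop, List.length_drop] at h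
  unfold constEnd at h ⊢
  omega

theorem constAt_eq_nil {l : List (Letter σ)} {x : ℕ} : constAt l x = [] ↔ ¬ IsBitAt l x := by
  rw [constAt, IsBitAt, ← Nat.add_zero x, ← List.getElem?_drop, Nat.add_zero]
  rcases l.drop x with _ | ⟨b | _ | s | R, t⟩ <;> simp [leadingBits]

theorem constAt_eq_cons {l : List (Letter σ)} {x : ℕ} {b : Bool} {c : Const} :
    constAt l x = b :: c ↔ l[x]? = some (.bit b) ∧ constAt l (x + 1) = c := by
  rw [constAt, constAt, ← List.drop_drop, ← Nat.add_zero x, ← List.getElem?_drop, Nat.add_zero]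
  rcases l.drop x with _ | ⟨b | _ | s | R, t⟩ <;> simp [leadingBits]

theorem getElem?_constAt {l : List (Letter σ)} {x d : ℕ} {b : Bool} :
    (constAt l x)[d]? = some b ↔ x + d < constEnd l x ∧ l[x + d]? = some (.bit b) := by
  rw [constEnd, Nat.add_lt_add_iff_left, ← List.getElem?_drop, ← map_constAt_append_drop]
  by_cases hd : d < (constAt l x).length
  · rw [List.getElem?_append_left (by simpa using hd)]
    simp [hd]
  · simp [hd]

theorem constEnd_eq_iff {l : List (Letter σ)} {x z : ℕ} :
    constEnd l x = z ↔ x ≤ z ∧ (∀ e, x ≤ e → e < z → IsBitAt l e) ∧ ¬ IsBitAt l z := by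
  have hbits : ∀ e, x ≤ e → e < constEnd l x → IsBitAt l e := fun e he hlt => by
    obtain ⟨d, rfl⟩ := Nat.exists_eq_add_of_le he
    have hd : d < (constAt l x).length := Nat.lt_of_add_lt_add_left hlt
    exact ⟨_, (getElem?_constAt.1 (List.getElem?_eq_getElem hd)).2⟩
  have hend : ¬ IsBitAt l (constEnd l x) := by
    rw [← constAt_eq_nil, constAt, constEnd, ← List.drop_drop]
    exact leadingBits_drop_length _
  refine ⟨?_, fun ⟨hx, hbits', hend'⟩ => ?_⟩
  · rintro rfl
    exact ⟨Nat.le_add_right _ _, hbits, hend⟩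
  · exact le_antisymm (not_lt.1 fun h => hend' (hbits z hx h))
      (not_lt.1 fun h => hend (hbits' _ (Nat.le_add_right _ _) h))

end Constants

section Facts

/-- The encoding of a list of constants. -/
def encodeConsts (cs : List Const) : List (Letter σ) :=
  cs.flatMap fun b => .sep :: b.map .bit

/-- The word is empty or begins with a relation symbol, so a tuple of constants ends before it. -/
def FactBoundary (l : List (Letter σ)) : Prop :=
  l = [] ∨ ∃ R t, l = .rel R :: t

theorem FactBoundary.leadingBits_encodeConsts_append {l : List (Letter σ)} (h : FactBoundary l) :
    ∀ cs, leadingBits (encodeConsts cs ++ l) = []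
  | [] => by rcases h with rfl | ⟨R, t, rfl⟩ <;> rfl
  | _ :: _ => rfl

/-- The constants `cs` are listed from position `x` up to a fact boundary. -/
def ConstsAt (l : List (Letter σ)) (x : ℕ) (cs : List Const) : Prop :=
  ∃ r, FactBoundary r ∧ l.drop x = encodeConsts cs ++ r

theorem constsAt_nil {l : List (Letter σ)} {x : ℕ} :
    ConstsAt l x [] ↔ l.length ≤ x ∨ ∃ R, l[x]? = some (.rel R) := by
  rw [ConstsAt, ← List.drop_eq_nil_iff, ← Nat.add_zero x, ← List.getElem?_drop, Nat.add_zero]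
  rcases l.drop x with _ | ⟨a, t⟩ <;> simp [FactBoundary, encodeConsts]

theorem constsAt_cons {l : List (Letter σ)} {x : ℕ} {c : Const} {cs : List Const} :
    ConstsAt l x (c :: cs) ↔ l[x]? = some .sep ∧ constAt l (x + 1) = c ∧
      ConstsAt l (constEnd l (x + 1)) cs := by
  constructor
  · rintro ⟨r, hr, h⟩
    have hx : l.drop x = .sep :: (c.map .bit ++ (encodeConsts cs ++ r)) := by
      simpa only [encodeConsts, List.flatMap_cons, List.cons_append, List.append_assoc] using h
    have hsucc : l.drop (x + 1) = c.map .bit ++ (encodeConsts cs ++ r) := by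
      rw [← List.drop_drop, hx]
      rfl
    have hc : constAt l (x + 1) = c := by
      rw [constAt, hsucc, leadingBits_map_append _ (hr.leadingBits_encodeConsts_append cs)]
    refine ⟨?_, hc, r, hr, ?_⟩
    · rw [← List.head?_drop, hx, List.head?_cons]
    · rw [constEnd, hc, ← List.drop_drop, hsucc, List.drop_left' (by simp)]
  · rintro ⟨h, rfl, r, hr, hrest⟩
    obtain ⟨hx, h⟩ := List.getElem?_eq_some_iff.1 h
    refine ⟨r, hr, ?_⟩
    rw [List.drop_eq_getElem_cons hx, h, ← map_constAt_append_drop, hrest]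
    simp [encodeConsts]

theorem not_constsAt_nil_of_constsAt_cons {l : List (Letter σ)} {x : ℕ} {c : Const}
    {cs : List Const} (h : ConstsAt l x (c :: cs)) : ¬ ConstsAt l x [] := by
  have hsep := (constsAt_cons.1 h).1
  rw [constsAt_nil]
  rintro (hx | ⟨R, hR⟩)
  · simp [List.getElem?_eq_none hx] at hsep
  · simp [hR] at hsep

theorem ConstsAt.unique {l : List (Letter σ)} {x : ℕ} {cs cs' : List Const}
    (h : ConstsAt l x cs) (h' : ConstsAt l x cs') : cs = cs' := by
  induction cs generalizing x cs' with
  | nil =>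
    cases cs' with
    | nil => rfl
    | cons => exact absurd h (not_constsAt_nil_of_constsAt_cons h')
  | cons c cs ih =>
    cases cs' with
    | nil => exact absurd h' (not_constsAt_nil_of_constsAt_cons h)
    | cons c' cs' =>
      obtain ⟨-, rfl, hcs⟩ := constsAt_cons.1 h
      obtain ⟨-, rfl, hcs'⟩ := constsAt_cons.1 h'
      rw [ih hcs hcs']

theorem ConstsAt.exists_constAt_eq {l : List (Letter σ)} {x : ℕ} {cs : List Const}
    (h : ConstsAt l x cs) {c : Const} (hc : c ∈ cs) : ∃ y : Position l, constAt l y = c := by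
  induction cs generalizing x with
  | nil => cases hc
  | cons c' cs ih =>
    obtain ⟨hsep, rfl, hcs⟩ := constsAt_cons.1 h
    rcases List.mem_cons.1 hc with rfl | hc
    · exact ⟨⟨x + 1, Nat.succ_lt_succ (List.getElem?_eq_some_iff.1 hsep).1⟩, rfl⟩
    · exact ih hcs hc

/-- The fact `f` is written at position `p`. -/
def FactAt (l : List (Letter σ)) (p : ℕ) (f : Fact σ Const) : Prop :=
  l[p]? = some (.rel f.rel) ∧ ConstsAt l (p + 1) (List.ofFn f.args)

theorem factAt_iff_drop {l : List (Letter σ)} {p : ℕ} {f : Fact σ Const} :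
    FactAt l p f ↔ ∃ r, FactBoundary r ∧ l.drop p = encodeFact f ++ r := by
  constructor
  · rintro ⟨h, r, hr, hargs⟩
    obtain ⟨hp, h⟩ := List.getElem?_eq_some_iff.1 h
    refine ⟨r, hr, ?_⟩
    rw [List.drop_eq_getElem_cons hp, h, hargs]
    rfl
  · rintro ⟨r, hr, h⟩
    refine ⟨by rw [← List.head?_drop, h]; rfl, r, hr, ?_⟩
    rw [← List.drop_drop, h]
    rfl

theorem FactAt.lt_length {l : List (Letter σ)} {p : ℕ} {f : Fact σ Const} (h : FactAt l p f) :
    p < l.length :=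
  (List.getElem?_eq_some_iff.1 h.1).1

theorem FactAt.unique {l : List (Letter σ)} {p : ℕ} {f g : Fact σ Const}
    (hf : FactAt l p f) (hg : FactAt l p g) : f = g := by
  obtain ⟨R, c⟩ := f
  obtain ⟨R', c'⟩ := g
  obtain rfl : R = R' := Letter.rel.inj (Option.some.inj (hf.1.symm.trans hg.1))
  exact congrArg (RelApp.mk R) (List.ofFn_injective (hf.2.unique hg.2))

theorem FactAt.exists_constAt_eq {l : List (Letter σ)} {p : ℕ} {f : Fact σ Const}
    (hf : FactAt l p f) (i : Fin (σ.arity f.rel)) : ∃ y : Position l, constAt l y = f.args i :=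
  hf.2.exists_constAt_eq (List.mem_ofFn.2 ⟨i, rfl⟩)

theorem factAt_append {s l : List (Letter σ)} {p : ℕ} {f : Fact σ Const} :
    FactAt (s ++ l) (s.length + p) f ↔ FactAt l p f := by
  rw [factAt_iff_drop, factAt_iff_drop, List.drop_length_add_append]

theorem factAt_cons {a : Letter σ} {l : List (Letter σ)} {p : ℕ} {f : Fact σ Const} :
    FactAt (a :: l) (p + 1) f ↔ FactAt l p f := by
  rw [factAt_iff_drop, factAt_iff_drop, List.drop_succ_cons]

theorem FactBoundary.factAt_encodeFact_append {l : List (Letter σ)} (h : FactBoundary l)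
    (f : Fact σ Const) : FactAt (encodeFact f ++ l) 0 f :=
  factAt_iff_drop.2 ⟨l, h, rfl⟩

end Facts

section Words

theorem factBoundary_flatMap_encodeFact : ∀ fs : List (Fact σ Const),
    FactBoundary (fs.flatMap encodeFact)
  | [] => .inl rfl
  | f :: _ => .inr ⟨f.rel, _, rfl⟩

theorem exists_add_of_rel_mem_encodeFact_append {f : Fact σ Const} {l : List (Letter σ)} {p : ℕ}
    {R : σ.Rel} (h : (encodeFact f ++ l)[p]? = some (.rel R)) (hp : p ≠ 0) :
    ∃ r, p = (encodeFact f).length + r ∧ l[r]? = some (.rel R) := by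
  obtain ⟨p, rfl⟩ := Nat.exists_eq_succ_of_ne_zero hp
  by_cases hlt : p + 1 < (encodeFact f).length
  · rw [Nat.succ_eq_add_one, List.getElem?_append_left hlt] at h
    have hmem : Letter.rel R ∈ encodeTuple σ f.args := List.mem_of_getElem? (i := p) h
    simp [encodeTuple] at hmem
  · obtain ⟨r, hr⟩ := Nat.exists_eq_add_of_le (not_lt.1 hlt)
    rw [Nat.succ_eq_add_one, hr, List.getElem?_append_right (Nat.le_add_right _ _),
      Nat.add_sub_cancel_left] at h
    exact ⟨r, hr, h⟩

theorem exists_mem_factAt_of_rel {fs : List (Fact σ Const)} {p : ℕ} {R : σ.Rel}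
    (h : (fs.flatMap encodeFact)[p]? = some (.rel R)) :
    ∃ f ∈ fs, FactAt (fs.flatMap encodeFact) p f := by
  induction fs generalizing p with
  | nil => simp at h
  | cons f fs ih =>
    rw [List.flatMap_cons] at h ⊢
    rcases eq_or_ne p 0 with rfl | hp
    · exact ⟨f, List.mem_cons_self,
        (factBoundary_flatMap_encodeFact fs).factAt_encodeFact_append f⟩
    · obtain ⟨r, rfl, hr⟩ := exists_add_of_rel_mem_encodeFact_append h hp
      obtain ⟨g, hg, hat⟩ := ih hr
      exact ⟨g, List.mem_cons_of_mem f hg, factAt_append.2 hat⟩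

theorem mem_iff_exists_factAt_flatMap {fs : List (Fact σ Const)} {f : Fact σ Const} :
    f ∈ fs ↔ ∃ p, FactAt (fs.flatMap encodeFact) p f := by
  constructor
  · intro hf
    obtain ⟨s, t, rfl⟩ := List.append_of_mem hf
    rw [List.flatMap_append, List.flatMap_cons]
    exact ⟨_, factAt_append.2 <|
      (factBoundary_flatMap_encodeFact t).factAt_encodeFact_append f⟩
  · rintro ⟨p, h⟩
    obtain ⟨g, hg, hat⟩ := exists_mem_factAt_of_rel h.1
    rwa [h.unique hat]

/-- Every relation symbol in the word begins a fact. -/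
def WellFormed (l : List (Letter σ)) : Prop :=
  ∀ p R, l[p]? = some (.rel R) → ∃ f, FactAt l p f

theorem wellFormed_cons {a : Letter σ} {l : List (Letter σ)} (ha : ∀ R, a ≠ .rel R) :
    WellFormed (a :: l) ↔ WellFormed l := by
  refine ⟨fun h p R hp => ?_, fun h p R hp => ?_⟩
  · obtain ⟨f, hf⟩ := h (p + 1) R hp
    exact ⟨f, factAt_cons.1 hf⟩
  · cases p with
    | zero => exact absurd (Option.some.inj hp) (ha R)
    | succ p =>
      obtain ⟨f, hf⟩ := h p R hp
      exact ⟨f, factAt_cons.2 hf⟩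

theorem WellFormed.of_append {s l : List (Letter σ)} (h : WellFormed (s ++ l)) :
    WellFormed l := fun p R hp => by
  obtain ⟨f, hf⟩ := h (s.length + p) R (by
    rwa [List.getElem?_append_right (Nat.le_add_right _ _), Nat.add_sub_cancel_left])
  exact ⟨f, factAt_append.1 hf⟩

theorem wellFormed_flatMap_encodeFact (fs : List (Fact σ Const)) :
    WellFormed (fs.flatMap encodeFact) := fun _ _ hp =>
  let ⟨f, _, hf⟩ := exists_mem_factAt_of_rel hp
  ⟨f, hf⟩

theorem WellFormed.exists_eq_flatMap {l : List (Letter σ)} (h : WellFormed l)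
    (hl : FactBoundary l) : ∃ fs : List (Fact σ Const), l = fs.flatMap encodeFact := by
  induction hm : l.length using Nat.strong_induction_on generalizing l with
  | _ m ih =>
    subst hm
    rcases hl with rfl | ⟨R, t, rfl⟩
    · exact ⟨[], rfl⟩
    · obtain ⟨f, hf⟩ := h 0 R rfl
      obtain ⟨r, hr, hf⟩ := factAt_iff_drop.1 hf
      rw [List.drop_zero] at hf
      rw [hf] at h ih ⊢
      obtain ⟨fs, rfl⟩ := ih r.length (by simp [encodeFact]) h.of_append hr rfl
      exact ⟨f :: fs, rfl⟩

theorem finite_setOf_factAt_ne_one (l : List (Letter σ)) :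
    {f | ∃ p, p ≠ 1 ∧ FactAt l p f}.Finite := by
  refine ((Set.finite_lt_nat l.length).biUnion (t := fun p => {f | FactAt l p f})
    fun p _ => Set.Subsingleton.finite fun f hf g hg => hf.unique hg).subset ?_
  rintro f ⟨p, -, hp⟩
  exact Set.mem_biUnion hp.lt_length hp

/-- The database listed in an input word: the facts written in it, except for the one at position
`1`, which belongs to the signed fact in question. -/
noncomputable def database (l : List (Letter σ)) : Finset (Fact σ Const) :=
  (finite_setOf_factAt_ne_one l).toFinset

theorem mem_database {l : List (Letter σ)} {f : Fact σ Const} :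
    f ∈ database l ↔ ∃ p, p ≠ 1 ∧ FactAt l p f :=
  Set.Finite.mem_toFinset _

theorem mem_database_encode {s : Bool} {f g : Fact σ Const} {fs : List (Fact σ Const)} :
    g ∈ database (encodeSignedFact (withSign s f) ++ fs.flatMap encodeFact) ↔ g ∈ fs := by
  rw [mem_database, mem_iff_exists_factAt_flatMap]
  change (∃ p, p ≠ 1 ∧ FactAt (.sign s :: (encodeFact f ++ fs.flatMap encodeFact)) p g) ↔ _
  refine ⟨fun ⟨p, hp, h⟩ => ?_, fun ⟨p, h⟩ => ?_⟩
  · cases p with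
    | zero => simpa using h.1
    | succ p =>
      rw [factAt_cons] at h
      obtain ⟨r, rfl, -⟩ := exists_add_of_rel_mem_encodeFact_append h.1 fun h0 => hp (by rw [h0])
      exact ⟨r, factAt_append.1 h⟩
  · refine ⟨(encodeFact f).length + p + 1, ?_, factAt_cons.2 (factAt_append.2 h)⟩
    simp [encodeFact]

theorem encodes_withSign_iff {l : List (Letter σ)} {D : Finset (Fact σ Const)} {s : Bool}
    {f : Fact σ Const} :
    Encodes l D (withSign s f) ↔
      l[0]? = some (.sign s) ∧ FactAt l 1 f ∧ WellFormed l ∧ D = database l := by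
  constructor
  · rintro ⟨fs, hfs, rfl⟩
    refine ⟨rfl, ?_, ?_, Finset.ext fun g => by rw [mem_database_encode, hfs]⟩
    · exact factAt_cons.2 <|
        (factBoundary_flatMap_encodeFact fs).factAt_encodeFact_append f
    · exact (wellFormed_cons (by simp)).2 (wellFormed_flatMap_encodeFact (f :: fs))
  · rintro ⟨hsign, hf, hwf, rfl⟩
    obtain ⟨r, hr, hf⟩ := factAt_iff_drop.1 hf
    obtain ⟨hl, hsign⟩ := List.getElem?_eq_some_iff.1 hsign
    have hlr : l = encodeSignedFact (withSign s f) ++ r := by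
      rw [← List.drop_zero (l := l), List.drop_eq_getElem_cons hl, hsign, hf]
      rfl
    rw [hlr] at hwf
    obtain ⟨fs, rfl⟩ := hwf.of_append.exists_eq_flatMap hr
    exact ⟨fs, fun g => by rw [hlr, mem_database_encode], hlr⟩

theorem mem_signedRelevanceProblem_iff {q : UCQNeg σ Const} {l : List (Letter σ)} :
    l ∈ signedRelevanceProblem q ↔ WellFormed l ∧ ∃ f s, l[0]? = some (.sign s) ∧ FactAt l 1 f ∧
      IsSignedRelevant q (database l) (withSign s f) := by
  constructor
  · rintro ⟨D, ⟨⟨s, R⟩, c⟩, henc, hrel⟩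
    obtain ⟨hs, hf, hwf, rfl⟩ := (encodes_withSign_iff (f := ⟨R, c⟩)).1 henc
    exact ⟨hwf, ⟨R, c⟩, s, hs, hf, hrel⟩
  · rintro ⟨hwf, f, s, hs, hf, hrel⟩
    exact ⟨database l, withSign s f, encodes_withSign_iff.2 ⟨hs, hf, hwf, rfl⟩, hrel⟩

end Words

/-! ### Relevance and images of assignments -/

section Relevance

variable {σ : Schema} {C : Type}

/-- The facts to which an assignment maps the positive atoms of a query. -/
def CQNeg.image (p : CQNeg σ C) (ν : Var → C) : Set (Fact σ C) :=
  {f | ∃ a ∈ p.pos, groundAtom ν a = f}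

/-- Two assignments agree on the variables of a query; by safety these are the variables of its
positive atoms. -/
def CQNeg.AgreeOn (p : CQNeg σ C) (ν ν' : Var → C) : Prop :=
  ∀ a ∈ p.pos, ∀ x, OccursIn x a → ν x = ν' x

theorem CQNeg.image_subset_iff {p : CQNeg σ C} {ν : Var → C} {S : Set (Fact σ C)} :
    p.image ν ⊆ S ↔ ∀ a ∈ p.pos, groundAtom ν a ∈ S :=
  ⟨fun h a ha => h ⟨a, ha, rfl⟩, by rintro h _ ⟨a, ha, rfl⟩; exact h a ha⟩

theorem CQNeg.satBy_signed_iff {p : CQNeg σ C} {S : Set (SignedFact σ C)} {ν : Var → C} :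
    p.signed.SatBy S ν ↔ p.signed.image ν ⊆ S ∧ ∀ e ∈ p.ineq, e.1.eval ν ≠ e.2.eval ν := by
  rw [image_subset_iff]
  exact and_congr_right fun _ => and_iff_right fun _ ha => absurd ha List.not_mem_nil

theorem QTerm.eval_congr {ν ν' : Var → C} :
    ∀ {t : QTerm C}, (∀ x, t = .var x → ν x = ν' x) → t.eval ν = t.eval ν'
  | .const _, _ => rfl
  | .var x, h => h x rfl

theorem CQNeg.AgreeOn.image_eq {p : CQNeg σ C} {ν ν' : Var → C} (h : p.AgreeOn ν ν') :
    p.image ν = p.image ν' := by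
  refine Set.ext fun f => exists_congr fun a => and_congr_right fun ha => ?_
  have : groundAtom ν a = groundAtom ν' a :=
    congrArg (RelApp.mk a.rel) (funext fun i => QTerm.eval_congr fun x hx => h a ha x ⟨i, hx⟩)
  rw [this]

theorem CQNeg.AgreeOn.satBy_signed {p : CQNeg σ C} {S : Set (SignedFact σ C)} {ν ν' : Var → C}
    (h : p.signed.AgreeOn ν ν') (hν : p.signed.SatBy S ν) : p.signed.SatBy S ν' := by
  rw [satBy_signed_iff] at hν ⊢
  refine ⟨h.image_eq ▸ hν.1, fun e he => ?_⟩
  have heq : ∀ x, e.1 = .var x ∨ e.2 = .var x → ν x = ν' x := fun x hx =>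
    let ⟨a, ha, hxa⟩ := p.signed.safe_ineq e he x hx
    h a ha x hxa
  rw [← QTerm.eval_congr fun x hx => heq x (.inl hx),
    ← QTerm.eval_congr fun x hx => heq x (.inr hx)]
  exact hν.2 e he

theorem holds_signed_iff {q : UCQNeg σ C} {S : Set (SignedFact σ C)} :
    UCQNeg.Holds (UCQNeg.signed q) S ↔ ∃ p ∈ q, ∃ ν, p.signed.SatBy S ν := by
  simp only [UCQNeg.Holds, UCQNeg.signed, List.mem_map, exists_exists_and_eq_and]

/-- `S` is the image of an assignment in `V` that satisfies `q±` in `D±`. -/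
def IsSignedImage (q : UCQNeg σ C) (D : Finset (Fact σ C)) (V : Set (Var → C))
    (S : Set (SignedFact σ C)) : Prop :=
  ∃ p ∈ q, ∃ ν ∈ V, p.signed.SatBy (signedDb D) ν ∧ p.signed.image ν = S

theorem minimal_isSignedSupport_iff {q : UCQNeg σ C} {D : Finset (Fact σ C)} {V : Set (Var → C)}
    (hV : ∀ p ∈ q, ∀ ν, p.signed.SatBy (signedDb D) ν → ∃ ν' ∈ V, p.signed.AgreeOn ν ν')
    {S : Set (SignedFact σ C)} :
    Minimal (IsSignedSupport q D) S ↔ Minimal (IsSignedImage q D V) S := by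
  refine minimal_iff_minimal_of_imp_of_forall ?_ ?_
  · rintro X ⟨p, hp, ν, -, hν, rfl⟩
    obtain ⟨himage, hineq⟩ := CQNeg.satBy_signed_iff.1 hν
    exact ⟨himage, holds_signed_iff.2
      ⟨p, hp, ν, CQNeg.satBy_signed_iff.2 ⟨subset_rfl, hineq⟩⟩⟩
  · rintro X ⟨hX, hq⟩
    obtain ⟨p, hp, ν, hν⟩ := holds_signed_iff.1 hq
    obtain ⟨himage, hineq⟩ := CQNeg.satBy_signed_iff.1 hν
    have hνD : p.signed.SatBy (signedDb D) ν :=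
      CQNeg.satBy_signed_iff.2 ⟨himage.trans hX, hineq⟩
    obtain ⟨ν', hν', hagree⟩ := hV p hp ν hνD
    exact ⟨p.signed.image ν', hagree.image_eq ▸ himage, p, hp, ν', hν',
      hagree.satBy_signed hνD, rfl⟩

/-- The assignment `ν` satisfies `p±` in `D±`, and no assignment in `V` satisfies a disjunct of `q±`
in `D±` with a strictly smaller image. -/
def IsMinimalMatch (q : UCQNeg σ C) (D : Finset (Fact σ C)) (V : Set (Var → C)) (p : CQNeg σ C)
    (ν : Var → C) : Prop :=
  p.signed.SatBy (signedDb D) ν ∧ ∀ p' ∈ q, ∀ ν' ∈ V, p'.signed.SatBy (signedDb D) ν' →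
    p'.signed.image ν' ⊆ p.signed.image ν → p.signed.image ν ⊆ p'.signed.image ν'

theorem isSignedRelevant_iff {q : UCQNeg σ C} {D : Finset (Fact σ C)} {V : Set (Var → C)}
    (hV : ∀ p ∈ q, ∀ ν, p.signed.SatBy (signedDb D) ν → ∃ ν' ∈ V, p.signed.AgreeOn ν ν')
    {α : SignedFact σ C} :
    IsSignedRelevant q D α ↔
      ∃ p ∈ q, ∃ ν ∈ V, IsMinimalMatch q D V p ν ∧ α ∈ p.signed.image ν := by
  simp only [IsSignedRelevant, minimal_isSignedSupport_iff hV]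
  constructor
  · rintro ⟨_, ⟨⟨p, hp, ν, hν, hsat, rfl⟩, hmin⟩, hα⟩
    exact ⟨p, hp, ν, hν, ⟨hsat, fun p' hp' ν' hν' hsat' => hmin ⟨p', hp', ν', hν', hsat', rfl⟩⟩, hα⟩
  · rintro ⟨p, hp, ν, hν, ⟨hsat, hmin⟩, hα⟩
    refine ⟨_, ⟨⟨p, hp, ν, hν, hsat, rfl⟩, ?_⟩, hα⟩
    rintro _ ⟨p', hp', ν', hν', hsat', rfl⟩
    exact hmin p' hp' ν' hν' hsat'

theorem withSign_inj {T : Type} {s s' : Bool} {a b : RelApp σ T} :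
    withSign s a = withSign s' b ↔ s = s' ∧ a = b := by
  refine ⟨fun h => ?_, fun ⟨hs, hab⟩ => hs ▸ hab ▸ rfl⟩
  obtain ⟨R, c⟩ := a
  obtain ⟨R', c'⟩ := b
  cases h
  exact ⟨rfl, rfl⟩

theorem withSign_true_mem_signedDb {D : Finset (Fact σ C)} {f : Fact σ C} :
    withSign true f ∈ signedDb D ↔ f ∈ D := by
  simp [signedDb, withSign_inj]

theorem withSign_false_mem_signedDb {D : Finset (Fact σ C)} {f : Fact σ C} :
    withSign false f ∈ signedDb D ↔
      (∀ i, f.args i ∈ activeDomain (D : Set (Fact σ C))) ∧ f ∉ D := by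
  simp [signedDb, withSign_inj, ← and_assoc]

theorem args_mem_activeDomain_of_mem_signedDb {D : Finset (Fact σ C)} {α : SignedFact σ C}
    (hα : α ∈ signedDb D) (i) : α.args i ∈ activeDomain (D : Set (Fact σ C)) := by
  rcases hα with ⟨f, hf, rfl⟩ | ⟨f, hdom, -, rfl⟩
  · exact ⟨f, hf, i, rfl⟩
  · exact hdom i

theorem exists_forall_occursIn_le (q : UCQNeg σ C) :
    ∃ N, ∀ p ∈ q, ∀ a ∈ p.pos, ∀ x, OccursIn x a → x ≤ N := by
  have hfin : (⋃ p ∈ {p | p ∈ q}, ⋃ a ∈ {a | a ∈ p.pos}, {x | OccursIn x a}).Finite := by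
    refine q.finite_toSet.biUnion fun p _ => p.pos.finite_toSet.biUnion fun a _ => ?_
    refine (Set.finite_iUnion fun i => Set.Subsingleton.finite (s := {x | a.args i = .var x})
      fun x hx y hy => QTerm.var.inj (hx.symm.trans hy)).subset ?_
    exact fun x ⟨i, hi⟩ => Set.mem_iUnion.2 ⟨i, hi⟩
  obtain ⟨N, hN⟩ := hfin.bddAbove
  exact ⟨N, fun p hp a ha x hx => hN (Set.mem_biUnion hp (Set.mem_biUnion ha hx))⟩

end Relevance

/-! ### Definability of relevance -/

variable {σ : Schema} {ι κ : Type}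

section Constants

theorem Definable.isBitAt (i : ι) : Definable fun (l : List (Letter σ)) v => IsBitAt l (v i) :=
  exists_finite fun b => letter (Letter.bit b) i

theorem DefinableNat.constEnd (i : ι) :
    DefinableNat fun (l : List (Letter σ)) v => constEnd l (v i) := by
  have hbits : Definable fun (l : List (Letter σ)) (v : Option ι → ℕ) =>
      ∀ e ≤ l.length, v (some i) ≤ e → e < v none → IsBitAt l e :=
    .forall_le (P := fun l v e => v (some i) ≤ e → e < v none → IsBitAt l e)
      ((Definable.le _ _).imp ((Definable.lt _ _).imp (.isBitAt _)))
  refine ((Definable.le (some i) none).and (hbits.and (Definable.isBitAt none).not)).congr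
    fun l v hv => ?_
  rw [eq_comm, constEnd_eq_iff]
  refine and_congr_right fun _ => and_congr_left fun _ => ?_
  exact ⟨fun h e he hlt => h e (hlt.le.trans (hv none)) he hlt, fun h e _ => h e⟩

theorem Definable.getElem?_constAt (i d : ι) (b : Bool) :
    Definable fun (l : List (Letter σ)) v => (constAt l (v i))[v d]? = some b := by
  have hlt : Definable fun (l : List (Letter σ)) (v : Option ι → ℕ) =>
      v none < constEnd l (v (some i)) :=
    .subst (P := fun _ v z => v none < z) (.lt _ _) (.constEnd _)
      fun l v hv _ => constEnd_le (hv _)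
  refine (Definable.subst (P := fun l v x => x < SignedRelevance.constEnd l (v i) ∧
    l[x]? = some (.bit b)) (hlt.and (.letter _ _)) (.add i d)
    fun l v _ h => (List.getElem?_eq_some_iff.1 h.2).1.le).congr fun l v _ => ?_
  exact SignedRelevance.getElem?_constAt.symm

theorem Definable.constAt_eq_constAt (i j : ι) :
    Definable fun (l : List (Letter σ)) v => constAt l (v i) = constAt l (v j) := by
  refine (Definable.forall_le (P := fun l v d => ∀ b : Bool,
    (constAt l (v i))[d]? = some b ↔ (constAt l (v j))[d]? = some b) <|
    .forall_finite fun b => (getElem?_constAt _ _ b).iff (getElem?_constAt _ _ b)).congr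
    fun l v hv => ⟨fun h => List.ext_getElem? fun d => ?_, fun h _ _ _ => by rw [h]⟩
  have hlength : ∀ k, (constAt l (v k)).length ≤ l.length := fun k =>
    (Nat.le_add_left _ _).trans (constEnd_le (hv k))
  by_cases hd : d ≤ l.length
  · exact Option.ext (h d hd)
  · rw [List.getElem?_eq_none ((hlength i).trans (not_le.1 hd).le),
      List.getElem?_eq_none ((hlength j).trans (not_le.1 hd).le)]

theorem Definable.constAt_eq_const (i : ι) (c : Const) :
    Definable fun (l : List (Letter σ)) v => constAt l (v i) = c := by
  induction c generalizing ι with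
  | nil => exact (isBitAt i).not.congr fun l v _ => constAt_eq_nil.symm
  | cons b c ih =>
    have hbit : Definable fun (l : List (Letter σ)) (v : Option ι → ℕ) =>
        l[v (some i)]? = some (.bit b) ∧ constAt l (v none) = c := (letter _ _).and (ih none)
    refine (Definable.subst (P := fun l v x => l[v i]? = some (.bit b) ∧ constAt l x = c)
      hbit (.succ i) fun l v _ h => ?_).congr fun l v _ => constAt_eq_cons.symm
    exact (List.getElem?_eq_some_iff.1 h.1).1

/-- A constant that depends on a word and positions in it and is either fixed or written at one of
the positions. -/
inductive ReadableConst : (List (Letter σ) → (ι → ℕ) → Const) → Prop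
  | const (c : Const) : ReadableConst fun _ _ => c
  | constAt (i : ι) : ReadableConst fun l v => constAt l (v i)

variable {F F' : List (Letter σ) → (ι → ℕ) → Const}

theorem ReadableConst.comp (hF : ReadableConst F) (f : ι → κ) :
    ReadableConst fun l (v : κ → ℕ) => F l fun i => v (f i) := by
  cases hF with
  | const c => exact .const c
  | constAt i => exact .constAt (f i)

theorem ReadableConst.definable_eq (hF : ReadableConst F) (hF' : ReadableConst F') :
    Definable fun l v => F l v = F' l v := by
  cases hF with
  | const c =>
    cases hF' with
    | const c' => exact .const (c = c')
    | constAt j => exact (Definable.constAt_eq_const j c).congr fun _ _ _ => eq_comm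
  | constAt i =>
    cases hF' with
    | const c => exact .constAt_eq_const i c
    | constAt j => exact .constAt_eq_constAt i j

theorem ReadableConst.definable_constsAt {Fs : List (List (Letter σ) → (ι → ℕ) → Const)}
    (hFs : ∀ F ∈ Fs, ReadableConst F) :
    Definable fun l (v : Option ι → ℕ) =>
      ConstsAt l (v none) (Fs.map fun F => F l fun i => v (some i)) := by
  have := σ.finite_rel
  induction Fs with
  | nil =>
    have hend : Definable fun (l : List (Letter σ)) (v : Option ι → ℕ) =>
        ∀ x ≤ l.length, x ≤ v none :=
      .forall_le (P := fun _ v x => x ≤ v none) (.le _ _)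
    refine (hend.or (.exists_finite fun R => .letter (.rel R) none)).congr fun l v _ => ?_
    rw [List.map_nil, constsAt_nil]
    exact or_congr_left ⟨fun h => h _ le_rfl, fun h x hx => hx.trans h⟩
  | cons F Fs ih =>
    have htail : Definable fun l (v : Option ι → ℕ) =>
        ConstsAt l (constEnd l (v none)) (Fs.map fun F => F l fun i => v (some i)) :=
      .subst (P := fun l v z => ConstsAt l z (Fs.map fun F => F l fun i => v (some i)))
        ((ih fun F hF => hFs F (List.mem_cons_of_mem _ hF)).comp (Option.map some))
        (.constEnd none) fun l v hv _ => constEnd_le (hv none)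
    have hhead : Definable fun l (v : Option ι → ℕ) =>
        SignedRelevance.constAt l (v none) = F l fun i => v (some i) :=
      (ReadableConst.constAt none).definable_eq ((hFs F List.mem_cons_self).comp some)
    refine (Definable.subst (P := fun l v y => l[v none]? = some .sep ∧
      SignedRelevance.constAt l y = F l (fun i => v (some i)) ∧
      ConstsAt l (constEnd l y) (Fs.map fun F => F l fun i => v (some i)))
      ((Definable.letter .sep _).and ((hhead.and htail).comp (Option.map some)))
      (.succ none) fun l v _ h => ?_).congr fun l v _ => constsAt_cons.symm
    exact (List.getElem?_eq_some_iff.1 h.1).1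

end Constants

section Facts

/-- A fact with a fixed relation symbol and readable constants as arguments. -/
inductive ReadableFact {τ : Schema} : (List (Letter σ) → (ι → ℕ) → Fact τ Const) → Prop
  | mk (R : τ.Rel) (F : Fin (τ.arity R) → List (Letter σ) → (ι → ℕ) → Const)
      (hF : ∀ j, ReadableConst (F j)) : ReadableFact fun l v => ⟨R, fun j => F j l v⟩

theorem ReadableFact.constAt {τ : Schema} (R : τ.Rel) (i : Fin (τ.arity R) → ι) :
    ReadableFact fun (l : List (Letter σ)) v =>
      (⟨R, fun j => SignedRelevance.constAt l (v (i j))⟩ : Fact τ Const) :=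
  .mk R _ fun j => .constAt (i j)

theorem ReadableFact.comp {τ : Schema} {G : List (Letter σ) → (ι → ℕ) → Fact τ Const}
    (hG : ReadableFact G) (f : ι → κ) :
    ReadableFact fun l (v : κ → ℕ) => G l fun i => v (f i) := by
  obtain ⟨R, F, hF⟩ := hG
  exact .mk R _ fun j => (hF j).comp f

theorem ReadableFact.definable_eq {τ : Schema}
    {G G' : List (Letter σ) → (ι → ℕ) → Fact τ Const}
    (hG : ReadableFact G) (hG' : ReadableFact G') : Definable fun l v => G l v = G' l v := by
  obtain ⟨R, F, hF⟩ := hG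
  obtain ⟨R', F', hF'⟩ := hG'
  by_cases hR : R = R'
  · subst hR
    exact (Definable.forall_finite fun j => (hF j).definable_eq (hF' j)).congr fun l v _ => by
      simp only [RelApp.mk.injEq, heq_eq_eq, true_and, funext_iff]
  · exact (Definable.const False).congr fun l v _ => by simp [hR]

variable {G : List (Letter σ) → (ι → ℕ) → Fact σ Const}

theorem ReadableFact.definable_factAt (hG : ReadableFact G) (i : ι) :
    Definable fun l v => FactAt l (v i) (G l v) := by
  obtain ⟨R, F, hF⟩ := hG
  have hargs : Definable fun l (v : Option ι → ℕ) =>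
      l[v (some i)]? = some (.rel R) ∧
        ConstsAt l (v none) (List.ofFn fun j => F j l fun i => v (some i)) := by
    refine (Definable.letter _ _).and ((ReadableConst.definable_constsAt
      (Fs := List.ofFn F) (by simpa [List.forall_mem_ofFn_iff] using hF)).congr fun l v _ => ?_)
    rw [List.map_ofFn]
    rfl
  exact .subst (P := fun l v x => l[v i]? = some (.rel R) ∧
    ConstsAt l x (List.ofFn fun j => F j l v)) hargs (.succ i)
    fun l v _ h => (List.getElem?_eq_some_iff.1 h.1).1

theorem Definable.exists_fact {P : List (Letter σ) → (ι → ℕ) → Fact σ Const → Prop}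
    (hP : ∀ R, Definable fun l (v : ι ⊕ Fin (σ.arity R) → ℕ) =>
      P l (fun i => v (.inl i)) ⟨R, fun j => constAt l (v (.inr j))⟩)
    (hwritten : ∀ l v f, P l v f → ∃ p, FactAt l p f) :
    Definable fun l v => ∃ f, P l v f := by
  have := σ.finite_rel
  refine (Definable.exists_finite fun R => .exists_tuple (P := fun l v u =>
    P l v ⟨R, fun j => constAt l (u j)⟩) (hP R)).congr fun l v _ => ?_
  refine ⟨fun ⟨R, u, h⟩ => ⟨_, h⟩, fun ⟨⟨R, c⟩, h⟩ => ?_⟩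
  obtain ⟨p, hp⟩ := hwritten l v _ h
  choose u hu using hp.exists_constAt_eq
  exact ⟨R, u, by simpa only [hu] using h⟩

theorem ReadableFact.definable_mem_database (hG : ReadableFact G) :
    Definable fun l v => G l v ∈ database l := by
  have hone : Definable fun (_ : List (Letter σ)) (v : Option ι → ℕ) => v none = 1 :=
    DefinableNat.const 1
  refine (Definable.exists_le (P := fun l v p => p ≠ 1 ∧ FactAt l p (G l v))
    (hone.not.and ((hG.comp some).definable_factAt none))).congr fun l v _ => ?_
  rw [mem_database]
  exact ⟨fun ⟨p, _, h⟩ => ⟨p, h⟩, fun ⟨p, h⟩ => ⟨p, h.2.lt_length.le, h⟩⟩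

theorem ReadableConst.definable_mem_activeDomain {F : List (Letter σ) → (ι → ℕ) → Const}
    (hF : ReadableConst F) :
    Definable fun l v => F l v ∈ activeDomain (database l : Set (Fact σ Const)) := by
  refine .exists_fact (P := fun l v f => f ∈ (database l : Set (Fact σ Const)) ∧
    ∃ i, f.args i = F l v) (fun R => ?_) fun l v f h => ?_
  · exact (ReadableFact.constAt R .inr).definable_mem_database.and <| .exists_finite fun j =>
      (ReadableConst.constAt (Sum.inr j)).definable_eq (hF.comp .inl)
  · obtain ⟨p, -, hp⟩ := mem_database.1 (Finset.mem_coe.1 h.1)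
    exact ⟨p, hp⟩

theorem definable_wellFormed :
    Definable fun (l : List (Letter σ)) (_ : ι → ℕ) => WellFormed l := by
  have := σ.finite_rel
  have hfact : Definable fun (l : List (Letter σ)) (v : Option ι → ℕ) =>
      ∃ f, FactAt l (v none) f :=
    .exists_fact (fun R => (ReadableFact.constAt R Sum.inr).definable_factAt (Sum.inl none))
      fun l v _ h => ⟨v none, h⟩
  refine (Definable.forall_finite fun R => .forall_le (P := fun l _ p =>
    l[p]? = some (.rel R) → ∃ f, FactAt l p f) ((Definable.letter _ _).imp hfact)).congr
    fun l v _ => ⟨fun h p R hp => h R p ?_ hp, fun h R p _ => h p R⟩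
  exact (List.getElem?_eq_some_iff.1 hp).1.le

theorem ReadableFact.definable_mem_signedDb {G : List (Letter σ) → (ι → ℕ) → SignedFact σ Const}
    (hG : ReadableFact G) : Definable fun l v => G l v ∈ signedDb (database l) := by
  obtain ⟨⟨s, R⟩, F, hF⟩ := hG
  have hmem : Definable fun l v => (⟨R, fun j => F j l v⟩ : Fact σ Const) ∈ database l :=
    (ReadableFact.mk R F hF).definable_mem_database
  cases s with
  | true => exact hmem.congr fun l v _ => withSign_true_mem_signedDb.symm
  | false =>
    have hdom : Definable fun l v =>
        ∀ j, F j l v ∈ activeDomain (database l : Set (Fact σ Const)) :=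
      .forall_finite fun j => (hF j).definable_mem_activeDomain
    exact (hdom.and hmem.not).congr fun l v _ =>
      (withSign_false_mem_signedDb (f := ⟨R, fun j => F j l v⟩)).symm

end Facts

section Assignments

/-- The assignment that gives `x` the constant written at position `u x`. -/
def readAssignment (l : List (Letter σ)) (u : Var → ℕ) : Var → Const :=
  fun x => constAt l (u x)

/-- The assignments whose values are written in `l`, two variables with the same value of `e` being
assigned the same constant. -/
def readAssignments (l : List (Letter σ)) (e : Var → κ) : Set (Var → Const) :=
  Set.range fun u : κ → Position l => readAssignment l fun x => u (e x)

theorem exists_agreeOn_mem_readAssignments {l : List (Letter σ)} {p : CQNeg σ Const}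
    {ν : Var → Const} (hν : p.signed.SatBy (signedDb (database l)) ν) {N : ℕ}
    (hN : ∀ a ∈ p.signed.pos, ∀ x, OccursIn x a → x ≤ N) :
    ∃ ν' ∈ readAssignments l (Fin.ofNat (N + 1)), p.signed.AgreeOn ν ν' := by
  refine ⟨_, ⟨fun j => Classical.epsilon fun y : Position l => constAt l y = ν j, rfl⟩,
    fun a ha x hx => ?_⟩
  have hxN : (Fin.ofNat (N + 1) x : ℕ) = x := Nat.mod_eq_of_lt (Nat.lt_succ_of_le (hN a ha x hx))
  obtain ⟨i, hi⟩ := hx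
  obtain ⟨f, hf, j, hj⟩ := args_mem_activeDomain_of_mem_signedDb (hν.1 a ha) i
  obtain ⟨k, -, hk⟩ := mem_database.1 (Finset.mem_coe.1 hf)
  obtain ⟨y, hy⟩ := hk.exists_constAt_eq j
  have hwritten : ∃ y : Position l, constAt l y = ν x := by
    refine ⟨y, hy.trans (hj.trans ?_)⟩
    simp only [groundAtom, hi, QTerm.eval]
  simp only [readAssignment, hxN]
  exact (Classical.epsilon_spec hwritten).symm

theorem Definable.exists_mem_readAssignments [Finite κ] (e : Var → κ)
    {P : List (Letter σ) → (ι → ℕ) → (Var → Const) → Prop}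
    (hP : Definable fun l (v : ι ⊕ κ → ℕ) =>
      P l (fun i => v (.inl i)) (readAssignment l fun x => v (.inr (e x)))) :
    Definable fun l v => ∃ ν ∈ readAssignments l e, P l v ν :=
  (exists_tuple (P := fun l v u => P l v (readAssignment l fun x => u (e x))) hP).congr
    fun _ _ _ => Set.exists_range_iff.symm

theorem Definable.forall_mem_readAssignments [Finite κ] (e : Var → κ)
    {P : List (Letter σ) → (ι → ℕ) → (Var → Const) → Prop}
    (hP : Definable fun l (v : ι ⊕ κ → ℕ) =>
      P l (fun i => v (.inl i)) (readAssignment l fun x => v (.inr (e x)))) :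
    Definable fun l v => ∀ ν ∈ readAssignments l e, P l v ν :=
  (exists_mem_readAssignments e (P := fun l v ν => ¬P l v ν) hP.not).not.congr
    fun _ _ _ => by simp only [not_exists, not_and, not_not]

variable {τ : Schema}

theorem ReadableConst.eval (t : QTerm Const) (e : Var → ι) :
    ReadableConst fun (l : List (Letter σ)) v => t.eval (readAssignment l fun x => v (e x)) := by
  cases t with
  | const c => exact .const c
  | var x => exact .constAt (e x)

theorem ReadableFact.groundAtom (a : Atom τ Const) (e : Var → ι) :
    ReadableFact fun (l : List (Letter σ)) v =>
      SignedRelevance.groundAtom (readAssignment l fun x => v (e x)) a :=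
  .mk a.rel _ fun j => .eval (a.args j) e

theorem ReadableFact.definable_mem_image {G : List (Letter σ) → (ι → ℕ) → Fact τ Const}
    (hG : ReadableFact G) (p : CQNeg τ Const) (e : Var → ι) :
    Definable fun l v => G l v ∈ p.image (readAssignment l fun x => v (e x)) :=
  .exists_mem p.pos fun a => (ReadableFact.groundAtom a e).definable_eq hG

theorem definable_image_subset_image (p p' : CQNeg τ Const) (e e' : Var → ι) :
    Definable fun (l : List (Letter σ)) v =>
      p.image (readAssignment l fun x => v (e x)) ⊆
        p'.image (readAssignment l fun x => v (e' x)) :=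
  (Definable.forall_mem p.pos fun a =>
    (ReadableFact.groundAtom a e).definable_mem_image p' e').congr
      fun _ _ _ => CQNeg.image_subset_iff.symm

theorem definable_satBy_signedDb (p : CQNeg σ.signed Const) (e : Var → ι) :
    Definable fun l v => p.SatBy (signedDb (database l)) (readAssignment l fun x => v (e x)) :=
  have hmem (a) := (ReadableFact.groundAtom a e).definable_mem_signedDb (σ := σ)
  have hineq : Definable fun (l : List (Letter σ)) v => ∀ c ∈ p.ineq,
      c.1.eval (readAssignment l fun x => v (e x)) ≠
        c.2.eval (readAssignment l fun x => v (e x)) :=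
    .forall_mem _ fun c => ((ReadableConst.eval c.1 e).definable_eq (.eval c.2 e)).not
  (Definable.forall_mem _ hmem).and ((Definable.forall_mem _ fun a => (hmem a).not).and hineq)

theorem definable_isMinimalMatch [Finite κ] (q : UCQNeg σ Const) (p : CQNeg σ Const) (e : Var → ι)
    (e' : Var → κ) :
    Definable fun l v => IsMinimalMatch q (database l) (readAssignments l e') p
      (readAssignment l fun x => v (e x)) := by
  refine (definable_satBy_signedDb p.signed e).and <| .forall_mem q fun p' =>
    .forall_mem_readAssignments e' (P := fun l v ν' => p'.signed.SatBy (signedDb (database l)) ν' →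
      p'.signed.image ν' ⊆ p.signed.image (readAssignment l fun x => v (e x)) →
      p.signed.image (readAssignment l fun x => v (e x)) ⊆ p'.signed.image ν') ?_
  exact (definable_satBy_signedDb p'.signed fun x => Sum.inr (e' x)).imp <|
    (definable_image_subset_image p'.signed p.signed (fun x => Sum.inr (e' x))
      fun x => Sum.inl (e x)).imp <|
    definable_image_subset_image p.signed p'.signed (fun x => Sum.inl (e x))
      fun x => Sum.inr (e' x)

theorem ReadableFact.definable_isSignedRelevant (q : UCQNeg σ Const)
    {G : List (Letter σ) → (ι → ℕ) → SignedFact σ Const} (hG : ReadableFact G) :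
    Definable fun l v => IsSignedRelevant q (database l) (G l v) := by
  obtain ⟨N, hN⟩ := exists_forall_occursIn_le (UCQNeg.signed q)
  let e : Var → Fin (N + 1) := Fin.ofNat (N + 1)
  have hmatch (p : CQNeg σ Const) : Definable fun l v => ∃ ν ∈ readAssignments l e,
      IsMinimalMatch q (database l) (readAssignments l e) p ν ∧ G l v ∈ p.signed.image ν :=
    .exists_mem_readAssignments e (P := fun l v ν =>
      IsMinimalMatch q (database l) (readAssignments l e) p ν ∧ G l v ∈ p.signed.image ν) <|
    (definable_isMinimalMatch q p (fun x => Sum.inr (e x)) e).and <|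
      (hG.comp Sum.inl).definable_mem_image p.signed fun x => Sum.inr (e x)
  exact (Definable.exists_mem q hmatch).congr fun l v _ => (isSignedRelevant_iff fun p hp ν hν =>
    exists_agreeOn_mem_readAssignments hν (hN _ (List.mem_map_of_mem hp))).symm

end Assignments

theorem definable_signedRelevanceProblem (q : UCQNeg σ Const) :
    Definable fun l (_ : ι → ℕ) => l ∈ signedRelevanceProblem q := by
  have hsign (ι : Type) (s : Bool) :
      Definable fun (l : List (Letter σ)) (_ : ι → ℕ) => l[0]? = some (.sign s) :=
    .subst (P := fun l _ x => l[x]? = some (Letter.sign s)) (.letter _ none) (.const 0)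
      fun l _ _ _ => Nat.zero_le _
  have hfact (R : σ.Rel) : Definable fun l (v : ι ⊕ Fin (σ.arity R) → ℕ) =>
      FactAt l 1 ⟨R, fun j => constAt l (v (.inr j))⟩ :=
    .subst (P := fun l v x => FactAt l x ⟨R, fun j => constAt l (v (Sum.inr j))⟩)
      ((ReadableFact.constAt R fun j => some (Sum.inr j)).definable_factAt none) (.const 1)
      fun l v _ h => h.lt_length.le
  have hrel : Definable fun l (_ : ι → ℕ) => ∃ f s, l[0]? = some (.sign s) ∧ FactAt l 1 f ∧
      IsSignedRelevant q (database l) (withSign s f) :=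
    .exists_fact (fun R => .exists_finite fun s => (hsign _ s).and <| (hfact R).and <|
      (ReadableFact.constAt (τ := σ.signed) (s, R) Sum.inr).definable_isSignedRelevant q)
      fun _ _ _ ⟨_, _, h, _⟩ => ⟨1, h⟩
  exact (definable_wellFormed.and hrel).congr fun _ _ _ => mem_signedRelevanceProblem_iff.symm

end SignedRelevance

theorem mainTheorem6 (σ : SignedRelevance.Schema)
    (q : SignedRelevance.UCQNeg σ SignedRelevance.Const) :
    SignedRelevance.InAC0 (SignedRelevance.signedRelevanceProblem q) := by
  exact (SignedRelevance.definable_signedRelevanceProblem q).inAC0
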